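/- Let $\Phi$ be a commutative unital ring, $G$ an abelian group, and $A=\bigoplus_{\sigma\in G}A_\sigma$ a $G$-graded associative (not necessarily unital) $\Phi$-algebra that is semiprime, i.e. has no nonzero two-sided ideal of square zero. Let $Q_s(A)$ be the symmetric Martindale algebra of quotients of $A$, and let $Q=\bigoplus_{\sigma\in G}Q_\sigma$ be a $G$-graded $\Phi$-algebra that is a subalgebra of $Q_s(A)$ containing $A$, with $A_\sigma\subseteq Q_\sigma$ for all $\sigma$. For an associative algebra $B$ let $B^-$ be the Lie algebra $B$ with $[x,y]=xy-yx$, let $[B,B]$ be the Lie ideal of $B^-$ spanned by the brackets, and for a Lie algebra $L$ let $Z_L=\{x\in L : [x,L]=0\}$ ($Z_B:=Z_{B^-}$). If $B$ is $G$-graded, then $B^-$, $[B,B]$ and their quotients by their centers carry the induced $G$-gradings. Let $M=\bigoplus M_\sigma$ be a $G$-graded Lie algebra and $L=\bigoplus L_\sigma$ a graded subalgebra. $M$ is a *graded algebra of quotients* of $L$ if for all $\sigma,\tau\in G$, $0\ne p\in M_\sigma$ and $q\in M_\tau$ there are $\alpha\in G$ and $x\in L_\alpha$ with $[x,p]\neq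 0$ and $[x,{}_L(q)]\subseteq L$, where ${}_L(q)$ is the linear span in $M$ of $q$ and all elements $\mathrm{ad}_{x_1}\cdots\mathrm{ad}_{x_n}q$ with $n\in\mathbb N$, $x_1,\dots,x_n\in L$. Then: (i) the inclusion $A\subseteq Q$ induces a graded Lie algebra monomorphism $A^- /Z_A\to Q^- /Z_Q$, and via it $Q^- /Z_Q$ is a graded algebra of quotients of $A^- /Z_A$; (ii) if moreover $A$ is 2-torsion free ($2a=0$ implies $a=0$ for $a\in A$), then the inclusion induces a graded Lie algebra monomorphism $[A,A]/Z_{[A,A]}\to [Q,Q]/Z_{[Q,Q]}$, and via it $[Q,Q]/Z_{[Q,Q]}$ is a graded algebra of quotients of $[A,A]/Z_{[A,A]}$. -/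

import Mathlib

/-! ### Semiprime associative algebras and their symmetric Martindale algebra of quotients -/

section Associative

variable (Φ : Type*) [CommRing Φ] (A : Type*) [NonUnitalRing A] [Module Φ A]

variable {Φ A} in
/-- A `Φ`-submodule of the (not necessarily unital) associative algebra `A` that is a two-sided
ideal. -/
structure IsTwoSidedIdeal (I : Submodule Φ A) : Prop where
  mul_mem_left : ∀ (a : A) {x : A}, x ∈ I → a * x ∈ I
  mul_mem_right : ∀ (a : A) {x : A}, x ∈ I → x * a ∈ I

/-- `A` is semiprime: it has no nonzero two-sided ideal of square zero. -/
class SemiprimeAlgebra : Prop where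
  eq_bot_of_sq_eq_zero : ∀ I : Submodule Φ A, IsTwoSidedIdeal I →
    (∀ x ∈ I, ∀ y ∈ I, x * y = 0) → I = ⊥

variable {Φ A} in
/-- A two-sided ideal with zero left and right annihilators in `A`. For a semiprime algebra these
are exactly the essential two-sided ideals. -/
structure IsDenseIdeal (I : Submodule Φ A) : Prop extends IsTwoSidedIdeal I where
  eq_zero_of_mul_left : ∀ z : A, (∀ x ∈ I, z * x = 0) → z = 0
  eq_zero_of_mul_right : ∀ z : A, (∀ x ∈ I, x * z = 0) → z = 0

/-- A compatible pair of partial multipliers: a homomorphism of right `A`-modules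
`left : dom → A` (`x ↦ q x`) and a homomorphism of left `A`-modules `right : dom → A` (`x ↦ x q`),
defined on a dense two-sided ideal `dom`, with `x (q y) = (x q) y`. -/
structure PartialMultiplier where
  dom : Submodule Φ A
  dense : IsDenseIdeal dom
  left : dom →ₗ[Φ] A
  right : dom →ₗ[Φ] A
  left_mul : ∀ (x : dom) (a : A), left ⟨x * a, dense.mul_mem_right a x.2⟩ = left x * a
  right_mul : ∀ (a : A) (x : dom), right ⟨a * x, dense.mul_mem_left a x.2⟩ = a * right x
  balanced : ∀ x y : dom, (x : A) * left y = right x * (y : A)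

variable {Φ A}

theorem IsDenseIdeal.inf {I J : Submodule Φ A} (hI : IsDenseIdeal I) (hJ : IsDenseIdeal J) :
    IsDenseIdeal (I ⊓ J) where
  mul_mem_left a _ hx := ⟨hI.mul_mem_left a hx.1, hJ.mul_mem_left a hx.2⟩
  mul_mem_right a _ hx := ⟨hI.mul_mem_right a hx.1, hJ.mul_mem_right a hx.2⟩
  eq_zero_of_mul_left z hz := by
    refine hI.eq_zero_of_mul_left z fun x hx => hJ.eq_zero_of_mul_left _ fun y hy => ?_
    rw [mul_assoc]
    exact hz _ ⟨hI.mul_mem_right y hx, hJ.mul_mem_left x hy⟩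
  eq_zero_of_mul_right z hz := by
    refine hI.eq_zero_of_mul_right z fun x hx => hJ.eq_zero_of_mul_right _ fun y hy => ?_
    rw [← mul_assoc]
    exact hz _ ⟨hI.mul_mem_left y hx, hJ.mul_mem_right x hy⟩

theorem isDenseIdeal_top [IsScalarTower Φ A A] [SMulCommClass Φ A A] [SemiprimeAlgebra Φ A] :
    IsDenseIdeal (⊤ : Submodule Φ A) where
  mul_mem_left _ _ _ := trivial
  mul_mem_right _ _ _ := trivial
  eq_zero_of_mul_left z hz := by
    let N : Submodule Φ A :=
      { carrier := {z | ∀ x : A, z * x = 0}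
        add_mem' := fun {a b} ha hb x => by rw [add_mul, ha x, hb x, add_zero]
        zero_mem' := fun x => zero_mul x
        smul_mem' := fun c a ha x => by rw [smul_mul_assoc, ha x, smul_zero] }
    have hN : N = ⊥ := SemiprimeAlgebra.eq_bot_of_sq_eq_zero N
      ⟨fun a x hx y => by rw [mul_assoc, hx y, mul_zero],
        fun a x hx y => by rw [mul_assoc, hx (a * y)]⟩ (fun x hx y _ => hx y)
    have : z ∈ N := fun x => hz x trivial
    rwa [hN, Submodule.mem_bot] at this
  eq_zero_of_mul_right z hz := by
    let N : Submodule Φ A :=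
      { carrier := {z | ∀ x : A, x * z = 0}
        add_mem' := fun {a b} ha hb x => by rw [mul_add, ha x, hb x, add_zero]
        zero_mem' := fun x => mul_zero x
        smul_mem' := fun c a ha x => by rw [mul_smul_comm, ha x, smul_zero] }
    have hN : N = ⊥ := SemiprimeAlgebra.eq_bot_of_sq_eq_zero N
      ⟨fun a x hx y => by rw [← mul_assoc, hx (y * a)],
        fun a x hx y => by rw [← mul_assoc, hx y, zero_mul]⟩ (fun x _ y hy => hy x)
    have : z ∈ N := fun x => hz x trivial
    rwa [hN, Submodule.mem_bot] at this

namespace PartialMultiplier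

/-- Two partial multipliers are identified when they agree on the intersection of their domains
(equivalently, on some dense ideal contained in both domains). -/
def Rel (p q : PartialMultiplier Φ A) : Prop :=
  ∀ (x : A) (hp : x ∈ p.dom) (hq : x ∈ q.dom),
    p.left ⟨x, hp⟩ = q.left ⟨x, hq⟩ ∧ p.right ⟨x, hp⟩ = q.right ⟨x, hq⟩

theorem rel_trans {p q s : PartialMultiplier Φ A} (h₁ : Rel p q) (h₂ : Rel q s) : Rel p s := by
  intro x hp hs
  constructor
  · refine sub_eq_zero.1 (q.dense.eq_zero_of_mul_left _ fun y hy => ?_)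
    have hq := q.dense.mul_mem_left x hy
    have e₁ := (h₁ (x * y) (p.dense.mul_mem_right y hp) hq).1
    have e₂ := (h₂ (x * y) hq (s.dense.mul_mem_right y hs)).1
    rw [sub_mul, ← p.left_mul ⟨x, hp⟩ y, ← s.left_mul ⟨x, hs⟩ y, sub_eq_zero]
    exact e₁.trans e₂
  · refine sub_eq_zero.1 (q.dense.eq_zero_of_mul_right _ fun y hy => ?_)
    have hq := q.dense.mul_mem_right x hy
    have e₁ := (h₁ (y * x) (p.dense.mul_mem_left y hp) hq).2
    have e₂ := (h₂ (y * x) hq (s.dense.mul_mem_left y hs)).2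
    rw [mul_sub, ← p.right_mul y ⟨x, hp⟩, ← s.right_mul y ⟨x, hs⟩, sub_eq_zero]
    exact e₁.trans e₂

variable (Φ A) in
/-- The setoid of partial multipliers. -/
def setoid : Setoid (PartialMultiplier Φ A) where
  r := Rel
  iseqv :=
    { refl := fun _ _ _ _ => ⟨rfl, rfl⟩
      symm := fun h x hp hq => ⟨(h x hq hp).1.symm, (h x hq hp).2.symm⟩
      trans := rel_trans }

/-- The sum of two partial multipliers, defined on the intersection of the domains. -/
def add (p q : PartialMultiplier Φ A) : PartialMultiplier Φ A where
  dom := p.dom ⊓ q.dom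
  dense := p.dense.inf q.dense
  left := p.left.comp (Submodule.inclusion inf_le_left) +
    q.left.comp (Submodule.inclusion inf_le_right)
  right := p.right.comp (Submodule.inclusion inf_le_left) +
    q.right.comp (Submodule.inclusion inf_le_right)
  left_mul x a := by
    have h₁ := p.left_mul ⟨x, x.2.1⟩ a
    have h₂ := q.left_mul ⟨x, x.2.2⟩ a
    simp only [LinearMap.add_apply, LinearMap.comp_apply, add_mul]
    exact congrArg₂ (· + ·) h₁ h₂
  right_mul a x := by
    have h₁ := p.right_mul a ⟨x, x.2.1⟩
    have h₂ := q.right_mul a ⟨x, x.2.2⟩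
    simp only [LinearMap.add_apply, LinearMap.comp_apply, mul_add]
    exact congrArg₂ (· + ·) h₁ h₂
  balanced x y := by
    have h₁ := p.balanced ⟨x, x.2.1⟩ ⟨y, y.2.1⟩
    have h₂ := q.balanced ⟨x, x.2.2⟩ ⟨y, y.2.2⟩
    simp only [LinearMap.add_apply, LinearMap.comp_apply, add_mul, mul_add]
    exact congrArg₂ (· + ·) h₁ h₂

/-- The multiple `c q` of a partial multiplier by a scalar `c`. -/
def smul [IsScalarTower Φ A A] [SMulCommClass Φ A A] (c : Φ) (p : PartialMultiplier Φ A) :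
    PartialMultiplier Φ A where
  dom := p.dom
  dense := p.dense
  left := c • p.left
  right := c • p.right
  left_mul x a := by simp only [LinearMap.smul_apply, p.left_mul, smul_mul_assoc]
  right_mul a x := by simp only [LinearMap.smul_apply, p.right_mul, mul_smul_comm]
  balanced x y := by
    simp only [LinearMap.smul_apply, mul_smul_comm, smul_mul_assoc, p.balanced]

theorem apply_mem_congr {I J : Submodule Φ A} (f : I →ₗ[Φ] A) {x : I} {y : A} (hy : y ∈ I)
    (h : (x : A) = y) (hx : f x ∈ J) : f ⟨y, hy⟩ ∈ J := by
  subst h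
  exact hx

/-- The domain of the product `p q`: the largest two-sided ideal on which `x ↦ p (q x)` and
`x ↦ (x p) q` are both defined. -/
def mulDom [IsScalarTower Φ A A] [SMulCommClass Φ A A] (p q : PartialMultiplier Φ A) :
    Submodule Φ A where
  carrier := {x | ∃ (hp : x ∈ p.dom) (hq : x ∈ q.dom),
    q.left ⟨x, hq⟩ ∈ p.dom ∧ (∀ a, q.left ⟨a * x, q.dense.mul_mem_left a hq⟩ ∈ p.dom) ∧
    p.right ⟨x, hp⟩ ∈ q.dom ∧ ∀ a, p.right ⟨x * a, p.dense.mul_mem_right a hp⟩ ∈ q.dom}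
  zero_mem' := by
    refine ⟨zero_mem _, zero_mem _, ?_, fun a => ?_, ?_, fun a => ?_⟩
    · exact (map_zero q.left).symm ▸ zero_mem p.dom
    · exact apply_mem_congr q.left _ (mul_zero a).symm ((map_zero q.left).symm ▸ zero_mem p.dom)
    · exact (map_zero p.right).symm ▸ zero_mem q.dom
    · exact apply_mem_congr p.right _ (zero_mul a).symm ((map_zero p.right).symm ▸ zero_mem q.dom)
  add_mem' := by
    rintro x y ⟨hp, hq, h₁, h₂, h₃, h₄⟩ ⟨hp', hq', h₁', h₂', h₃', h₄'⟩
    refine ⟨add_mem hp hp', add_mem hq hq', ?_, fun a => ?_, ?_, fun a => ?_⟩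
    · have := add_mem h₁ h₁'
      rwa [← map_add] at this
    · have := add_mem (h₂ a) (h₂' a)
      rw [← map_add] at this
      exact apply_mem_congr q.left _ (mul_add a x y).symm this
    · have := add_mem h₃ h₃'
      rwa [← map_add] at this
    · have := add_mem (h₄ a) (h₄' a)
      rw [← map_add] at this
      exact apply_mem_congr p.right _ (add_mul x y a).symm this
  smul_mem' := by
    rintro c x ⟨hp, hq, h₁, h₂, h₃, h₄⟩
    refine ⟨p.dom.smul_mem c hp, q.dom.smul_mem c hq, ?_, fun a => ?_, ?_, fun a => ?_⟩
    · have := p.dom.smul_mem c h₁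
      rwa [← map_smul] at this
    · have := p.dom.smul_mem c (h₂ a)
      rw [← map_smul] at this
      exact apply_mem_congr q.left _ (mul_smul_comm c a x).symm this
    · have := q.dom.smul_mem c h₃
      rwa [← map_smul] at this
    · have := q.dom.smul_mem c (h₄ a)
      rw [← map_smul] at this
      exact apply_mem_congr p.right _ (smul_mul_assoc c x a).symm this

section mul

variable [IsScalarTower Φ A A] [SMulCommClass Φ A A]

theorem mulDom_le_left (p q : PartialMultiplier Φ A) : mulDom p q ≤ p.dom := fun _ h => h.1

theorem mulDom_le_right (p q : PartialMultiplier Φ A) : mulDom p q ≤ q.dom := fun _ h => h.2.1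

theorem mul_mem_mulDom (p q : PartialMultiplier Φ A) {x y : A} (hx : x ∈ p.dom ⊓ q.dom)
    (hy : y ∈ p.dom ⊓ q.dom) : x * y ∈ mulDom p q := by
  have L : ∀ z (hz : z ∈ q.dom), q.left ⟨z * y, q.dense.mul_mem_right y hz⟩ ∈ p.dom := by
    intro z hz
    rw [q.left_mul ⟨z, hz⟩ y]
    exact p.dense.mul_mem_left _ hy.1
  have R : ∀ z (hz : z ∈ p.dom), p.right ⟨x * z, p.dense.mul_mem_left x hz⟩ ∈ q.dom := by
    intro z hz
    rw [p.right_mul x ⟨z, hz⟩]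
    exact q.dense.mul_mem_right _ hx.2
  refine ⟨p.dense.mul_mem_right y hx.1, q.dense.mul_mem_right y hx.2, L x hx.2, fun a => ?_,
    R y hy.1, fun a => ?_⟩
  · simpa only [mul_assoc] using L (a * x) (q.dense.mul_mem_left a hx.2)
  · simpa only [mul_assoc] using R (y * a) (p.dense.mul_mem_right a hy.1)

theorem isDenseIdeal_mulDom (p q : PartialMultiplier Φ A) : IsDenseIdeal (mulDom p q) where
  mul_mem_left := by
    rintro b x ⟨hp, hq, h₁, h₂, h₃, h₄⟩
    refine ⟨p.dense.mul_mem_left b hp, q.dense.mul_mem_left b hq, h₂ b, fun a => ?_, ?_,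
      fun a => ?_⟩
    · simpa only [mul_assoc] using h₂ (a * b)
    · rw [p.right_mul b ⟨x, hp⟩]
      exact q.dense.mul_mem_left b h₃
    · have := q.dense.mul_mem_left b (h₄ a)
      rw [← p.right_mul b ⟨x * a, _⟩] at this
      simpa only [mul_assoc] using this
  mul_mem_right := by
    rintro b x ⟨hp, hq, h₁, h₂, h₃, h₄⟩
    refine ⟨p.dense.mul_mem_right b hp, q.dense.mul_mem_right b hq, ?_, fun a => ?_, h₄ b,
      fun a => ?_⟩
    · rw [q.left_mul ⟨x, hq⟩ b]
      exact p.dense.mul_mem_right b h₁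
    · have := p.dense.mul_mem_right b (h₂ a)
      rw [← q.left_mul ⟨a * x, _⟩ b] at this
      simpa only [mul_assoc] using this
    · simpa only [mul_assoc] using h₄ (b * a)
  eq_zero_of_mul_left z hz := by
    have hI := p.dense.inf q.dense
    refine hI.eq_zero_of_mul_left z fun x hx => hI.eq_zero_of_mul_left _ fun y hy => ?_
    rw [mul_assoc]
    exact hz _ (mul_mem_mulDom p q hx hy)
  eq_zero_of_mul_right z hz := by
    have hI := p.dense.inf q.dense
    refine hI.eq_zero_of_mul_right z fun x hx => hI.eq_zero_of_mul_right _ fun y hy => ?_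
    rw [← mul_assoc]
    exact hz _ (mul_mem_mulDom p q hy hx)

/-- The product of two partial multipliers: `x ↦ p (q x)` on the left, `x ↦ (x p) q` on the
right. -/
def mul (p q : PartialMultiplier Φ A) : PartialMultiplier Φ A where
  dom := mulDom p q
  dense := isDenseIdeal_mulDom p q
  left := p.left.comp ((q.left.comp (Submodule.inclusion (mulDom_le_right p q))).codRestrict p.dom
    fun x => x.2.2.2.1)
  right := q.right.comp ((p.right.comp (Submodule.inclusion (mulDom_le_left p q))).codRestrict
    q.dom fun x => x.2.2.2.2.2.1)
  left_mul x a := by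
    have h := q.left_mul ⟨x, x.2.2.1⟩ a
    have h' := p.left_mul ⟨q.left ⟨x, x.2.2.1⟩, x.2.2.2.1⟩ a
    refine Eq.trans ?_ h'
    exact congrArg p.left (Subtype.ext h)
  right_mul a x := by
    have h := p.right_mul a ⟨x, x.2.1⟩
    have h' := q.right_mul a ⟨p.right ⟨x, x.2.1⟩, x.2.2.2.2.2.1⟩
    refine Eq.trans ?_ h'
    exact congrArg q.right (Subtype.ext h)
  balanced x y := by
    have h := p.balanced ⟨x, x.2.1⟩ ⟨q.left ⟨y, y.2.2.1⟩, y.2.2.2.1⟩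
    have h' := q.balanced ⟨p.right ⟨x, x.2.1⟩, x.2.2.2.2.2.1⟩ ⟨y, y.2.2.1⟩
    exact h.trans h'

/-- Multiplication by an element `a` of `A`, a multiplier defined on all of `A`. -/
def ofElem [SemiprimeAlgebra Φ A] (a : A) : PartialMultiplier Φ A where
  dom := ⊤
  dense := isDenseIdeal_top
  left := (LinearMap.mulLeft Φ a).comp (Submodule.subtype ⊤)
  right := (LinearMap.mulRight Φ a).comp (Submodule.subtype ⊤)
  left_mul x b := (mul_assoc a (x : A) b).symm
  right_mul b x := mul_assoc b (x : A) a
  balanced x y := (mul_assoc (x : A) a (y : A)).symm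

end mul

end PartialMultiplier

variable (Φ A) in
/-- The symmetric Martindale algebra of quotients `Q_s(A)` of a semiprime algebra `A`. -/
def SymmetricQuotients : Type _ := Quotient (PartialMultiplier.setoid Φ A)

namespace SymmetricQuotients

open PartialMultiplier

variable [IsScalarTower Φ A A] [SMulCommClass Φ A A]

instance : Add (SymmetricQuotients Φ A) :=
  ⟨Quotient.map₂ PartialMultiplier.add fun _ _ h _ _ h' x hp hq =>
    ⟨congrArg₂ (· + ·) (h x hp.1 hq.1).1 (h' x hp.2 hq.2).1,
      congrArg₂ (· + ·) (h x hp.1 hq.1).2 (h' x hp.2 hq.2).2⟩⟩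

instance : SMul Φ (SymmetricQuotients Φ A) :=
  ⟨fun c => Quotient.map (PartialMultiplier.smul c) fun _ _ h x hp hq =>
    ⟨congrArg (c • ·) (h x hp hq).1, congrArg (c • ·) (h x hp hq).2⟩⟩

instance : Mul (SymmetricQuotients Φ A) :=
  ⟨Quotient.map₂ PartialMultiplier.mul fun p p' h q q' h' x hx hx' => by
    have e := h' x hx.2.1 hx'.2.1
    have f := h x hx.1 hx'.1
    constructor
    · have m : q.left ⟨x, hx.2.1⟩ ∈ p'.dom := by
        rw [e.1]; exact hx'.2.2.1
      refine (h (q.left ⟨x, hx.2.1⟩) hx.2.2.1 m).1.trans ?_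
      exact congrArg p'.left (Subtype.ext e.1)
    · have m : p.right ⟨x, hx.1⟩ ∈ q'.dom := by
        rw [f.2]; exact hx'.2.2.2.2.1
      refine (h' (p.right ⟨x, hx.1⟩) hx.2.2.2.2.1 m).2.trans ?_
      exact congrArg q'.right (Subtype.ext f.2)⟩

variable [SemiprimeAlgebra Φ A]

instance : Zero (SymmetricQuotients Φ A) := ⟨Quotient.mk _ (ofElem 0)⟩

instance : Neg (SymmetricQuotients Φ A) := ⟨fun q => (-1 : Φ) • q⟩

instance : NonUnitalRing (SymmetricQuotients Φ A) where
  add_assoc := by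
    rintro ⟨p⟩ ⟨q⟩ ⟨s⟩
    exact Quotient.sound fun x _ _ => ⟨add_assoc _ _ _, add_assoc _ _ _⟩
  zero_add := by
    rintro ⟨p⟩
    refine Quotient.sound fun x hx hx' => ⟨?_, ?_⟩
    · exact (congrArg (· + p.left ⟨x, hx'⟩) (zero_mul x)).trans (zero_add _)
    · exact (congrArg (· + p.right ⟨x, hx'⟩) (mul_zero x)).trans (zero_add _)
  add_zero := by
    rintro ⟨p⟩
    refine Quotient.sound fun x hx hx' => ⟨?_, ?_⟩
    · exact (congrArg (p.left ⟨x, hx'⟩ + ·) (zero_mul x)).trans (add_zero _)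
    · exact (congrArg (p.right ⟨x, hx'⟩ + ·) (mul_zero x)).trans (add_zero _)
  add_comm := by
    rintro ⟨p⟩ ⟨q⟩
    exact Quotient.sound fun x _ _ => ⟨add_comm _ _, add_comm _ _⟩
  neg_add_cancel := by
    rintro ⟨p⟩
    refine Quotient.sound fun x hx hx' => ⟨?_, ?_⟩
    · refine Eq.trans ?_ (zero_mul x).symm
      change (-1 : Φ) • p.left ⟨x, hx.1⟩ + p.left ⟨x, hx.1⟩ = 0
      rw [neg_one_smul, neg_add_cancel]
    · refine Eq.trans ?_ (mul_zero x).symm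
      change (-1 : Φ) • p.right ⟨x, hx.1⟩ + p.right ⟨x, hx.1⟩ = 0
      rw [neg_one_smul, neg_add_cancel]
  nsmul := nsmulRec
  zsmul := zsmulRec
  mul_assoc := by
    rintro ⟨p⟩ ⟨q⟩ ⟨s⟩
    exact Quotient.sound fun x _ _ => ⟨rfl, rfl⟩
  left_distrib := by
    rintro ⟨p⟩ ⟨q⟩ ⟨s⟩
    refine Quotient.sound fun x hx hx' => ⟨?_, rfl⟩
    exact map_add p.left ⟨q.left ⟨x, hx'.1.2.1⟩, hx'.1.2.2.1⟩ ⟨s.left ⟨x, hx'.2.2.1⟩, hx'.2.2.2.1⟩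
  right_distrib := by
    rintro ⟨p⟩ ⟨q⟩ ⟨s⟩
    refine Quotient.sound fun x hx hx' => ⟨rfl, ?_⟩
    exact map_add s.right ⟨p.right ⟨x, hx'.1.1⟩, hx'.1.2.2.2.2.1⟩
      ⟨q.right ⟨x, hx'.2.1⟩, hx'.2.2.2.2.2.1⟩
  zero_mul := by
    rintro ⟨p⟩
    refine Quotient.sound fun x hx _ => ⟨?_, ?_⟩
    · exact (zero_mul (p.left ⟨x, hx.2.1⟩)).trans (zero_mul x).symm
    · refine Eq.trans ?_ ((map_zero p.right).trans (mul_zero x).symm)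
      exact congrArg p.right (Subtype.ext (mul_zero x))
  mul_zero := by
    rintro ⟨p⟩
    refine Quotient.sound fun x hx _ => ⟨?_, ?_⟩
    · refine Eq.trans ?_ ((map_zero p.left).trans (zero_mul x).symm)
      exact congrArg p.left (Subtype.ext (zero_mul x))
    · exact (mul_zero (p.right ⟨x, hx.1⟩)).trans (mul_zero x).symm

instance : Module Φ (SymmetricQuotients Φ A) where
  one_smul := by
    rintro ⟨p⟩
    exact Quotient.sound fun x _ _ => ⟨one_smul _ _, one_smul _ _⟩
  mul_smul := by
    rintro c d ⟨p⟩
    exact Quotient.sound fun x _ _ => ⟨mul_smul _ _ _, mul_smul _ _ _⟩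
  smul_zero := by
    intro c
    refine Quotient.sound fun x _ _ => ⟨?_, ?_⟩
    · exact (congrArg (c • ·) (zero_mul x)).trans ((smul_zero c).trans (zero_mul x).symm)
    · exact (congrArg (c • ·) (mul_zero x)).trans ((smul_zero c).trans (mul_zero x).symm)
  smul_add := by
    rintro c ⟨p⟩ ⟨q⟩
    exact Quotient.sound fun x _ _ => ⟨smul_add _ _ _, smul_add _ _ _⟩
  add_smul := by
    rintro c d ⟨p⟩
    exact Quotient.sound fun x _ _ => ⟨add_smul _ _ _, add_smul _ _ _⟩
  zero_smul := by
    rintro ⟨p⟩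
    refine Quotient.sound fun x hx _ => ⟨?_, ?_⟩
    · exact (zero_smul Φ (p.left ⟨x, hx⟩)).trans (zero_mul x).symm
    · exact (zero_smul Φ (p.right ⟨x, hx⟩)).trans (mul_zero x).symm

instance : IsScalarTower Φ (SymmetricQuotients Φ A) (SymmetricQuotients Φ A) where
  smul_assoc := by
    rintro c ⟨p⟩ ⟨q⟩
    refine Quotient.sound fun x hx hx' => ⟨rfl, ?_⟩
    exact map_smul q.right c ⟨p.right ⟨x, hx'.1⟩, hx'.2.2.2.2.1⟩

instance : SMulCommClass Φ (SymmetricQuotients Φ A) (SymmetricQuotients Φ A) where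
  smul_comm := by
    rintro c ⟨p⟩ ⟨q⟩
    refine Quotient.sound fun x hx hx' => ⟨?_, rfl⟩
    exact (map_smul p.left c ⟨q.left ⟨x, hx.2.1⟩, hx.2.2.1⟩).symm

variable (Φ A) in
/-- The canonical homomorphism `A → Q_s(A)`; it is injective because `A` is semiprime. -/
def incl : A →ₙₐ[Φ] SymmetricQuotients Φ A where
  toFun a := Quotient.mk _ (ofElem a)
  map_smul' c a := Quotient.sound fun x _ _ => ⟨smul_mul_assoc c a x, mul_smul_comm c x a⟩
  map_zero' := rfl
  map_add' a b := Quotient.sound fun x _ _ => ⟨add_mul a b x, mul_add x a b⟩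
  map_mul' a b := Quotient.sound fun x _ _ => ⟨mul_assoc a b x, (mul_assoc x a b).symm⟩

end SymmetricQuotients

end Associative

/-! ### The Lie algebra of an associative algebra -/

/-- The Lie algebra `A⁻` of an associative algebra `A`: the module `A` with `[x, y] = xy - yx`. -/
def MinusAlgebra (A : Type*) : Type _ := A

namespace MinusAlgebra

variable (Φ : Type*) [CommRing Φ] {A : Type*} [NonUnitalRing A] [Module Φ A]

instance : AddCommGroup (MinusAlgebra A) := inferInstanceAs (AddCommGroup A)

instance : Module Φ (MinusAlgebra A) := inferInstanceAs (Module Φ A)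

/-- The identity map `A → A⁻`. -/
def of : A ≃ₗ[Φ] MinusAlgebra A := LinearEquiv.refl Φ A

instance : LieRing (MinusAlgebra A) where
  bracket := fun (x y : A) => (x * y - y * x : A)
  add_lie := fun (x y z : A) => show (x + y) * z - z * (x + y) =
      (x * z - z * x) + (y * z - z * y) by
    rw [add_mul, mul_add, add_sub_add_comm]
  lie_add := fun (x y z : A) => show x * (y + z) - (y + z) * x =
      (x * y - y * x) + (x * z - z * x) by
    rw [add_mul, mul_add, add_sub_add_comm]
  lie_self := fun (x : A) => sub_self (x * x)
  leibniz_lie := fun (x y z : A) => show x * (y * z - z * y) - (y * z - z * y) * x =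
      ((x * y - y * x) * z - z * (x * y - y * x)) +
      (y * (x * z - z * x) - (x * z - z * x) * y) by
    simp only [mul_sub, sub_mul, mul_assoc]
    abel

instance [IsScalarTower Φ A A] [SMulCommClass Φ A A] : LieAlgebra Φ (MinusAlgebra A) where
  lie_smul := fun (c : Φ) (x y : A) => show x * (c • y) - (c • y) * x = c • (x * y - y * x) by
    rw [mul_smul_comm, smul_mul_assoc, smul_sub]

end MinusAlgebra

/-! ### Graded algebras of quotients of graded Lie algebras -/

section Lie

open DirectSum

variable {G : Type*} [AddCommGroup G] [DecidableEq G] {Φ : Type*} [CommRing Φ]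

/-- `L = ⨁ L_σ` is a `G`-graded Lie algebra. -/
structure IsLieGrading {L : Type*} [LieRing L] [LieAlgebra Φ L] (𝓛 : G → Submodule Φ L) :
    Prop where
  isInternal : IsInternal 𝓛
  graded : SetLike.GradedBracket 𝓛

variable {L M : Type*} [LieRing L] [LieAlgebra Φ L] [LieRing M] [LieAlgebra Φ M]

/-- For a subalgebra `L` of `M` (given by its inclusion `f`) and `q : M`, the linear span in `M`
of `q` and of all `ad x₁ ⋯ ad xₙ q` with `x₁, …, xₙ ∈ L`. -/
def adSpan (f : L →ₗ⁅Φ⁆ M) (q : M) : Submodule Φ M :=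
  Submodule.span Φ {m | ∃ l : List L, m = l.foldr (fun x y => ⁅f x, y⁆) q}

/-- `f` identifies the graded Lie algebra `L` with a graded subalgebra of the graded Lie algebra
`M`, and `M` is a graded algebra of quotients of `L`. -/
structure IsGradedAlgebraOfQuotients (𝓛 : G → Submodule Φ L) (𝓜 : G → Submodule Φ M)
    (f : L →ₗ⁅Φ⁆ M) : Prop where
  grading_sub : IsLieGrading 𝓛
  grading : IsLieGrading 𝓜
  injective : Function.Injective f
  map_mem : ∀ σ, ∀ x ∈ 𝓛 σ, f x ∈ 𝓜 σ
  absorb : ∀ σ τ, ∀ p ∈ 𝓜 σ, p ≠ 0 → ∀ q ∈ 𝓜 τ, ∃ α, ∃ x ∈ 𝓛 α,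
    ⁅f x, p⁆ ≠ 0 ∧ ∀ m ∈ adSpan f q, ⁅f x, m⁆ ∈ f.range

variable (Φ) in
/-- The Lie algebra `L / Z_L`. -/
abbrev ModCenter (L : Type*) [LieRing L] [LieAlgebra Φ L] : Type _ := L ⧸ LieAlgebra.center Φ L

variable (Φ) in
/-- The canonical projection `L → L / Z_L`. -/
abbrev toModCenter (L : Type*) [LieRing L] [LieAlgebra Φ L] : L →ₗ[Φ] ModCenter Φ L :=
  (LieSubmodule.Quotient.mk' (LieAlgebra.center Φ L) : L →ₗ[Φ] ModCenter Φ L)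

/-- The grading of `L / Z_L` induced by a grading of `L`. -/
def modCenterGrading (𝓛 : G → Submodule Φ L) (σ : G) : Submodule Φ (ModCenter Φ L) :=
  (𝓛 σ).map (toModCenter Φ L)

variable (Φ) in
/-- The derived ideal `[L, L]` (the linear span of the brackets), itself a Lie algebra. -/
abbrev derivedIdeal (L : Type*) [LieRing L] [LieAlgebra Φ L] : LieIdeal Φ L :=
  ⁅(⊤ : LieIdeal Φ L), (⊤ : LieIdeal Φ L)⁆

/-- The grading of `[L, L]` induced by a grading of `L`: `[L, L]_σ = [L, L] ∩ L_σ`. -/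
def derivedGrading (𝓛 : G → Submodule Φ L) (σ : G) : Submodule Φ (derivedIdeal Φ L) :=
  (𝓛 σ).comap (derivedIdeal Φ L).toSubmodule.subtype

/-- The grading of `A⁻` given by a grading of the associative algebra `A`. -/
def minusGrading {A : Type*} [NonUnitalRing A] [Module Φ A] (𝒜 : G → Submodule Φ A) (σ : G) :
    Submodule Φ (MinusAlgebra A) :=
  (𝒜 σ).map (MinusAlgebra.of Φ : A ≃ₗ[Φ] MinusAlgebra A).toLinearMap

end Lie

/-! ### Commutators in a non-unital ring -/

section Commutator

variable {R : Type*} [NonUnitalRing R]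

/-! Only two properties of `Q` matter, collected in `HasDenseDenominators`: each element of `Q` is
multiplied into `A` from both sides by some dense ideal of `A`, and a dense ideal annihilates no
nonzero element of `Q`.

On the Lie side, `exists_isGradedAlgebraOfQuotients_modCenter` reduces both assertions to one task.
Given homogeneous `p` and `q` with `p` not central, find a set `U` in the small Lie algebra, stable
under brackets with it, such that `[U, q]` lies in the small algebra and some homogeneous `x ∈ U`
has `[x, p]` not central. Stability of `U` then handles the whole span of the `ad x₁ ⋯ ad xₙ q`.

For `A⁻`, take for `U` a dense ideal `I` with `[I, q] ⊆ A`; for `[A, A]`, take `[I, I]`. Since `q`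
is homogeneous, `I` can be enlarged to an ideal spanned by homogeneous elements (`exists_graded`).
If no homogeneous `x` worked, linearity would make `[p, I]`, respectively `[p, [I, I]]`, central.
Herstein-type arguments then force `p` to be central: `lie_eq_zero_of_lie_central`, and
`lie_eq_zero_of_lie_lie_central`, where the absence of 2-torsion enters. The centers match because
`Z_A = A ∩ Z_Q` and `Z_[Q,Q] = [Q,Q] ∩ Z_Q`. -/

theorem ring_lie_mul (p x y : R) : ⁅p, x * y⁆ = ⁅p, x⁆ * y + x * ⁅p, y⁆ := by
  simp only [Ring.lie_def, mul_sub, sub_mul, mul_assoc]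
  abel

theorem ring_mul_lie (x y p : R) : ⁅x * y, p⁆ = x * ⁅y, p⁆ + ⁅x, p⁆ * y := by
  simp only [Ring.lie_def, mul_sub, sub_mul, mul_assoc]
  abel

theorem ring_lie_add (p x y : R) : ⁅p, x + y⁆ = ⁅p, x⁆ + ⁅p, y⁆ := by
  simp only [Ring.lie_def, mul_add, add_mul]
  abel

theorem ring_lie_lie (p x y : R) : ⁅p, ⁅x, y⁆⁆ = ⁅⁅p, x⁆, y⁆ + ⁅x, ⁅p, y⁆⁆ := by
  simp only [Ring.lie_def, mul_sub, sub_mul, mul_assoc]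
  abel

theorem ring_lie_self (x : R) : ⁅x, x⁆ = 0 := sub_self _

theorem ring_lie_eq_zero_symm {x y : R} (h : ⁅x, y⁆ = 0) : ⁅y, x⁆ = 0 :=
  commute_iff_lie_eq.1 (commute_iff_lie_eq.2 h).symm

end Commutator

/-! ### Dense ideals -/

section Dense

variable {Φ : Type*} [CommRing Φ] {A : Type*} [NonUnitalRing A] [Module Φ A]

theorem IsDenseIdeal.eq_zero_of_mul_mul {I : Submodule Φ A} (hI : IsDenseIdeal I) (z : A)
    (h : ∀ x ∈ I, ∀ y ∈ I, z * (x * y) = 0) : z = 0 :=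
  hI.eq_zero_of_mul_left z fun x hx => hI.eq_zero_of_mul_left _ fun y hy => by
    rw [mul_assoc, h x hx y hy]

theorem IsDenseIdeal.eq_zero_of_mul_mul' {I : Submodule Φ A} (hI : IsDenseIdeal I) (z : A)
    (h : ∀ x ∈ I, ∀ y ∈ I, x * y * z = 0) : z = 0 :=
  hI.eq_zero_of_mul_right z fun y hy => hI.eq_zero_of_mul_right _ fun x hx => by
    rw [← mul_assoc, h x hx y hy]

variable [IsScalarTower Φ A A] [SMulCommClass Φ A A]

/-- The square of a two-sided ideal, spanned by the products of its elements. -/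
def sqIdeal (I : Submodule Φ A) : Submodule Φ A :=
  Submodule.span Φ {z | ∃ x ∈ I, ∃ y ∈ I, z = x * y}

theorem IsTwoSidedIdeal.span {s : Set A} (hl : ∀ a, ∀ x ∈ s, a * x ∈ Submodule.span Φ s)
    (hr : ∀ a, ∀ x ∈ s, x * a ∈ Submodule.span Φ s) : IsTwoSidedIdeal (Submodule.span Φ s) where
  mul_mem_left a x hx := by
    have : Submodule.span Φ s ≤ (Submodule.span Φ s).comap (LinearMap.mulLeft Φ a) :=
      Submodule.span_le.2 fun x hx => hl a x hx
    exact this hx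
  mul_mem_right a x hx := by
    have : Submodule.span Φ s ≤ (Submodule.span Φ s).comap (LinearMap.mulRight Φ a) :=
      Submodule.span_le.2 fun x hx => hr a x hx
    exact this hx

theorem IsDenseIdeal.sqIdeal {I : Submodule Φ A} (hI : IsDenseIdeal I) :
    IsDenseIdeal (sqIdeal I) where
  toIsTwoSidedIdeal := by
    refine IsTwoSidedIdeal.span ?_ ?_
    · rintro a _ ⟨x, hx, y, hy, rfl⟩
      exact Submodule.subset_span ⟨a * x, hI.mul_mem_left a hx, y, hy, (mul_assoc _ _ _).symm⟩
    · rintro a _ ⟨x, hx, y, hy, rfl⟩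
      exact Submodule.subset_span ⟨x, hx, y * a, hI.mul_mem_right a hy, mul_assoc _ _ _⟩
  eq_zero_of_mul_left z hz := hI.eq_zero_of_mul_mul z fun x hx y hy =>
    hz _ (Submodule.subset_span ⟨x, hx, y, hy, rfl⟩)
  eq_zero_of_mul_right z hz := hI.eq_zero_of_mul_mul' z fun x hx y hy =>
    hz _ (Submodule.subset_span ⟨x, hx, y, hy, rfl⟩)

/-- The ideal spanned by `A b A` has square zero, hence vanishes. Without a unit it need not visibly
contain `b`, so the outer factors are stripped using that `A` has no annihilators in itself. -/
theorem SemiprimeAlgebra.eq_zero_of_mul_mul_self [SemiprimeAlgebra Φ A] {b : A}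
    (hb : ∀ a, b * a * b = 0) : b = 0 := by
  have hD : IsDenseIdeal (⊤ : Submodule Φ A) := isDenseIdeal_top
  let s : Set A := {z | ∃ x y, z = x * b * y}
  have hs : IsTwoSidedIdeal (Submodule.span Φ s) := by
    refine IsTwoSidedIdeal.span ?_ ?_
    · rintro a _ ⟨x, y, rfl⟩
      exact Submodule.subset_span ⟨a * x, y, by simp only [mul_assoc]⟩
    · rintro a _ ⟨x, y, rfl⟩
      exact Submodule.subset_span ⟨x, y * a, by simp only [mul_assoc]⟩
  have h1 : ∀ z ∈ s, ∀ w ∈ s, z * w = 0 := by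
    rintro _ ⟨x, y, rfl⟩ _ ⟨x', y', rfl⟩
    have : x * b * y * (x' * b * y') = x * (b * (y * x') * b) * y' := by simp only [mul_assoc]
    rw [this, hb, mul_zero, zero_mul]
  have h2 : ∀ z ∈ s, Submodule.span Φ s ≤ LinearMap.ker (LinearMap.mulLeft Φ z) := fun z hz =>
    Submodule.span_le.2 fun w hw => h1 z hz w hw
  have h3 : ∀ w ∈ Submodule.span Φ s,
      Submodule.span Φ s ≤ LinearMap.ker (LinearMap.mulRight Φ w) := fun w hw =>
    Submodule.span_le.2 fun z hz => h2 z hz hw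
  have h4 := SemiprimeAlgebra.eq_bot_of_sq_eq_zero _ hs fun x hx y hy => h3 y hy hx
  refine hD.eq_zero_of_mul_right b fun x _ => hD.eq_zero_of_mul_left _ fun y _ => ?_
  have : x * b * y ∈ Submodule.span Φ s := Submodule.subset_span ⟨x, y, rfl⟩
  rwa [h4, Submodule.mem_bot] at this

end Dense

/-! ### Algebras of quotients with dense denominator ideals -/

section Denominators

variable {Φ : Type*} [CommRing Φ] {A : Type*} [NonUnitalRing A] [Module Φ A]
  {Q : Type*} [NonUnitalRing Q] [Module Φ Q]

/-- `ι` embeds `A` into `Q` such that every element of `Q` is carried into `A` by multiplication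
from both sides with some dense ideal of `A`, and no nonzero element of `Q` is annihilated on one
side by a dense ideal. -/
structure HasDenseDenominators (ι : A →ₙₐ[Φ] Q) : Prop where
  injective : Function.Injective ι
  exists_dense : ∀ q, ∃ I : Submodule Φ A, IsDenseIdeal I ∧
    (∀ x ∈ I, ∃ a, ι a = q * ι x) ∧ ∀ x ∈ I, ∃ a, ι a = ι x * q
  eq_zero_of_mul_left : ∀ I : Submodule Φ A, IsDenseIdeal I → ∀ q, (∀ x ∈ I, q * ι x = 0) → q = 0
  eq_zero_of_mul_right : ∀ I : Submodule Φ A, IsDenseIdeal I → ∀ q, (∀ x ∈ I, ι x * q = 0) → q = 0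

namespace HasDenseDenominators

theorem map_lie (ι : A →ₙₐ[Φ] Q) (x y : A) : ι ⁅x, y⁆ = ⁅ι x, ι y⁆ := by
  simp only [Ring.lie_def, map_sub, map_mul]

/-- The elements `q x`, with `x` in a dense ideal, lie in `A`, so `Q` inherits the absence of
2-torsion. -/
theorem eq_zero_of_add_self {ι : A →ₙₐ[Φ] Q} (h : HasDenseDenominators ι) (h2 : ∀ a : A, a + a = 0 → a = 0)
    {q : Q} (hq : q + q = 0) : q = 0 := by
  obtain ⟨I, hI, hl, -⟩ := h.exists_dense q
  refine h.eq_zero_of_mul_left I hI q fun x hx => ?_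
  obtain ⟨a, ha⟩ := hl x hx
  rw [← ha, h2 a (h.injective ?_), map_zero]
  rw [map_add, ha, ← add_mul, hq, zero_mul, map_zero]

variable [IsScalarTower Φ A A] [SMulCommClass Φ A A] [IsScalarTower Φ Q Q] [SMulCommClass Φ Q Q]
  {ι : A →ₙₐ[Φ] Q}

/-- If `J` carries `q` into `A`, then on products of `x, y ∈ K ⊓ J` one has `q (x y) = (q x) y ∈ A K
⊆ K` and `(x y) q = x (y q) ∈ K A ⊆ K`. Hence the square of `K ⊓ J` serves. -/
theorem exists_dense_le (h : HasDenseDenominators ι) {K : Submodule Φ A} (hK : IsDenseIdeal K)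
    (q : Q) : ∃ I ≤ K, IsDenseIdeal I ∧
      (∀ x ∈ I, ∃ a ∈ K, ι a = q * ι x) ∧ ∀ x ∈ I, ∃ a ∈ K, ι a = ι x * q := by
  obtain ⟨J, hJ, hl, hr⟩ := h.exists_dense q
  have key : sqIdeal (K ⊓ J) ≤
      (K.map (ι : A →ₗ[Φ] Q)).comap (LinearMap.mulLeft Φ q ∘ₗ (ι : A →ₗ[Φ] Q)) ⊓
      (K.map (ι : A →ₗ[Φ] Q)).comap (LinearMap.mulRight Φ q ∘ₗ (ι : A →ₗ[Φ] Q)) := by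
    refine Submodule.span_le.2 ?_
    rintro _ ⟨x, hx, y, hy, rfl⟩
    obtain ⟨a, ha⟩ := hl x hx.2
    obtain ⟨b, hb⟩ := hr y hy.2
    exact ⟨⟨a * y, hK.mul_mem_left a hy.1, by simp [ha, mul_assoc]⟩,
      ⟨x * b, hK.mul_mem_right b hx.1, by simp [hb, mul_assoc]⟩⟩
  refine ⟨sqIdeal (K ⊓ J), ?_, (hK.inf hJ).sqIdeal, fun x hx => (key hx).1,
    fun x hx => (key hx).2⟩
  refine Submodule.span_le.2 ?_
  rintro _ ⟨x, hx, y, _, rfl⟩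
  exact hK.mul_mem_right y hx.1

/-- An element commuting with a dense ideal is central. -/
theorem lie_eq_zero_of_dense (h : HasDenseDenominators ι) {K : Submodule Φ A}
    (hK : IsDenseIdeal K) {p : Q} (hp : ∀ x ∈ K, ⁅p, ι x⁆ = 0) (z : Q) : ⁅p, z⁆ = 0 := by
  obtain ⟨I, hIK, hI, -, hr⟩ := h.exists_dense_le hK z
  refine h.eq_zero_of_mul_right I hI _ fun x hx => ?_
  -- Both `x` and `x z` lie in `K`, so `0 = [p, x z] = [p, x] z + x [p, z] = x [p, z]`.
  obtain ⟨a, ha, ea⟩ := hr x hx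
  have := hp a ha
  rwa [ea, ring_lie_mul, hp x (hIK hx), zero_mul, zero_add] at this

variable [SemiprimeAlgebra Φ A]

/-- Semiprimeness of `A` passes to `Q`: for `b = q x ∈ A` one has `b a b = (q (x a) q) x = 0`, so `q
x = 0` on a dense ideal. -/
theorem eq_zero_of_mul_mul_self (h : HasDenseDenominators ι) {K : Submodule Φ A}
    (hK : IsDenseIdeal K) {q : Q} (hq : ∀ x ∈ K, q * ι x * q = 0) : q = 0 := by
  obtain ⟨I, hIK, hI, hl, -⟩ := h.exists_dense_le hK q
  refine h.eq_zero_of_mul_left I hI q fun x hx => ?_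
  obtain ⟨b, -, hb⟩ := hl x hx
  have : b = 0 := SemiprimeAlgebra.eq_zero_of_mul_mul_self (Φ := Φ) fun a => h.injective <| by
    have e := hq (x * a) (hK.mul_mem_right a (hIK hx))
    rw [map_mul] at e
    rw [map_mul, map_mul, hb, map_zero, mul_assoc q, ← mul_assoc, e, zero_mul]
  rw [← hb, this, map_zero]

theorem eq_zero_of_central_of_sq (h : HasDenseDenominators ι) {c : Q} (hc : ∀ z : Q, ⁅c, z⁆ = 0)
    (hsq : c * c = 0) : c = 0 :=
  h.eq_zero_of_mul_mul_self isDenseIdeal_top fun x _ => by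
    rw [sub_eq_zero.1 (hc (ι x)), mul_assoc, hsq, mul_zero]

/-- If all commutators of `p` with a dense ideal are central, then `p` is central. -/
theorem lie_eq_zero_of_lie_central (h : HasDenseDenominators ι) {K : Submodule Φ A}
    (hK : IsDenseIdeal K) {p : Q} (hp : ∀ x ∈ K, ∀ z : Q, ⁅⁅p, ι x⁆, z⁆ = 0) (z : Q) : ⁅p, z⁆ = 0 := by
  obtain ⟨I, hIK, hI, -, hr⟩ := h.exists_dense_le hK p
  refine h.lie_eq_zero_of_dense hI (fun x hx => ?_) z
  refine h.eq_zero_of_central_of_sq (hp x (hIK hx)) ?_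
  -- Since `x p ∈ K`, the element `[p, x p] = [p, x] p` is central. Bracketing it with `x` leaves
  -- `[p, x]² = 0`, because `[p, x]` is central too.
  obtain ⟨a, ha, ea⟩ := hr x hx
  have := hp a ha (ι x)
  rwa [ea, ring_lie_mul, ring_lie_self, mul_zero, add_zero, ring_mul_lie, hp x (hIK hx),
    zero_mul, add_zero] at this

/-- If `p` commutes with all commutators of elements of a dense ideal, then `p` is central. -/
theorem lie_eq_zero_of_lie_lie_eq_zero (h : HasDenseDenominators ι) {K : Submodule Φ A}
    (hK : IsDenseIdeal K) {p : Q} (hp : ∀ x ∈ K, ∀ y ∈ K, ⁅p, ⁅ι x, ι y⁆⁆ = 0) (z : Q) :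
    ⁅p, z⁆ = 0 := by
  obtain ⟨I, hIK, hI, -, hr⟩ := h.exists_dense_le hK p
  -- Expand `[p, [x, y p]] = 0`, which applies because `y p ∈ K`.
  have key : ∀ y ∈ I, ∀ x ∈ K, ⁅p, ι y⁆ * ⁅ι x, p⁆ + ι y * ⁅p, ⁅ι x, p⁆⁆ = 0 := by
    intro y hy x hx
    obtain ⟨a, ha, ea⟩ := hr y hy
    have := hp x hx a ha
    rwa [ea, ring_lie_mul (ι x), ring_lie_add, ring_lie_mul p, ring_lie_mul p,
      hp x hx y (hIK hy), zero_mul, zero_add, ring_lie_self, mul_zero, zero_add] at this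
  -- Replacing `y` by `t y` in `key` and subtracting `t` times `key` isolates this term. For `t = x`
  -- it says `[p, x] y [p, x] = 0`, up to sign.
  have key2 : ∀ t ∈ I, ∀ y ∈ I, ∀ x ∈ K, ⁅p, ι t⁆ * ι y * ⁅ι x, p⁆ = 0 := by
    intro t ht y hy x hx
    have e := key (t * y) (hI.mul_mem_left t hy) x hx
    have e' := congrArg (ι t * ·) (key y hy x hx)
    simp only [mul_add, mul_zero] at e'
    rw [map_mul, ring_lie_mul, add_mul, add_assoc, mul_assoc (ι t), mul_assoc (ι t), e',
      add_zero] at e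
    exact e
  refine h.lie_eq_zero_of_dense hI (fun x hx => ?_) z
  refine h.eq_zero_of_mul_mul_self hI fun y hy => ?_
  have := key2 x hx y hy x (hIK hx)
  rwa [← neg_eq_zero, ← mul_neg, Ring.lie_def (ι x), neg_sub] at this

/-- In the absence of `2`-torsion, if `p` has central commutators with all commutators of
elements of a dense ideal, then `p` is central. -/
theorem lie_eq_zero_of_lie_lie_central (h : HasDenseDenominators ι)
    (h2 : ∀ a : A, a + a = 0 → a = 0) {K : Submodule Φ A} (hK : IsDenseIdeal K) {p : Q}
    (hp : ∀ x ∈ K, ∀ y ∈ K, ∀ z : Q, ⁅⁅p, ⁅ι x, ι y⁆⁆, z⁆ = 0) (z : Q) : ⁅p, z⁆ = 0 := by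
  refine h.lie_eq_zero_of_lie_lie_eq_zero hK (fun a ha b hb => ?_) z
  obtain ⟨u, hu⟩ : ∃ u, u = ⁅a, b⁆ := ⟨_, rfl⟩
  have huK : u ∈ K := by
    rw [hu, Ring.lie_def]
    exact K.sub_mem (hK.mul_mem_right b ha) (hK.mul_mem_right a hb)
  have hιu : ι u = ⁅ι a, ι b⁆ := by rw [hu, map_lie]
  -- The central element `c = [p, u]` is to be shown zero, by way of `c [u, x] = 0` for all `x ∈ K`
  -- and then `c² = 0`.
  obtain ⟨c, hc⟩ : ∃ c, c = ⁅p, ι u⁆ := ⟨_, rfl⟩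
  have hcz : ∀ z : Q, ⁅c, z⁆ = 0 := by rw [hc, hιu]; exact hp a ha b hb
  have hcomm : ∀ z : Q, c * z = z * c := fun z => sub_eq_zero.1 (hcz z)
  rw [← hιu, ← hc]
  -- the second commutators with `u` are annihilated by `c`
  have d1 : ∀ x, ⁅p, ⁅ι u, ι x⁆⁆ = ⁅ι u, ⁅p, ι x⁆⁆ := fun x => by
    rw [ring_lie_lie, ← hc, hcz, zero_add]
  have s1 : ∀ x ∈ K, c * ⁅ι u, ⁅ι u, ι x⁆⁆ = 0 := by
    intro x hx
    -- Both this element and `[p, [u, x]]` are central. Bracketing with `u` therefore kills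
    -- everything except `c [u, [u, x]]`.
    have e1 : ⁅p, ⁅ι u, ι (u * x)⁆⁆ = c * ⁅ι u, ι x⁆ + ι u * ⁅p, ⁅ι u, ι x⁆⁆ := by
      rw [map_mul, ring_lie_mul (ι u), ring_lie_self, zero_mul, zero_add, ring_lie_mul, ← hc]
    have e2 := ring_lie_eq_zero_symm (hp u huK (u * x) (hK.mul_mem_left u hx) (ι u))
    rwa [e1, ring_lie_add, ring_lie_mul, ring_lie_mul, ring_lie_self, zero_mul, zero_add,
      ring_lie_eq_zero_symm (hp u huK x hx (ι u)), mul_zero, add_zero,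
      ring_lie_eq_zero_symm (hcz (ι u)), zero_mul, zero_add] at e2
  -- In `[u, [u, x y]]` the outer Leibniz terms are killed by `c` through `s1`; the middle term
  -- occurs twice, which is why 2-torsion must be excluded.
  have s2 : ∀ x ∈ K, ∀ y ∈ K, c * ⁅ι u, ι x⁆ * ⁅ι u, ι y⁆ = 0 := by
    intro x hx y hy
    refine h.eq_zero_of_add_self h2 ?_
    have e := s1 (x * y) (hK.mul_mem_right y hx)
    have ex := s1 x hx
    have ey : c * (ι x * ⁅ι u, ⁅ι u, ι y⁆⁆) = 0 := by
      rw [← mul_assoc, hcomm, mul_assoc, s1 y hy, mul_zero]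
    rw [map_mul, ring_lie_mul (ι u) (ι x), ring_lie_add, ring_lie_mul, ring_lie_mul, mul_add,
      mul_add, mul_add, ← mul_assoc, ex, zero_mul, zero_add, ey, add_zero, ← mul_assoc] at e
    exact e
  -- Putting `y x` for `y` in `s2` gives `c [u, x] y [u, x] = 0`, so semiprimeness applies to `c [u,
  -- x]`.
  have s3 : ∀ x ∈ K, c * ⁅ι u, ι x⁆ = 0 := by
    intro x hx
    refine h.eq_zero_of_mul_mul_self hK fun y hy => ?_
    have e := s2 x hx (y * x) (hK.mul_mem_left y hx)
    rw [map_mul, ring_lie_mul, mul_add, ← mul_assoc, s2 x hx y hy, zero_mul, zero_add,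
      ← mul_assoc] at e
    rw [hcomm ⁅ι u, ι x⁆, ← mul_assoc _ _ c, ← hcomm ⁅ι u, ι x⁆, e, zero_mul]
  have s4 : ∀ x ∈ K, ⁅c * ι u, ι x⁆ = 0 := fun x hx => by
    rw [ring_mul_lie, s3 x hx, hcz, zero_mul, zero_add]
  -- By `s4` the element `c u` is central, so `0 = [p, c u] = c [p, u] = c²`.
  have s5 := ring_lie_eq_zero_symm (h.lie_eq_zero_of_dense hK s4 p)
  rw [ring_lie_mul, ring_lie_eq_zero_symm (hcz p), zero_mul, zero_add, ← hc] at s5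
  exact h.eq_zero_of_central_of_sq hcz s5

end HasDenseDenominators

end Denominators

/-! ### Subalgebras of the symmetric Martindale algebra of quotients -/

namespace SymmetricQuotients

open PartialMultiplier

variable {Φ : Type*} [CommRing Φ] {A : Type*} [NonUnitalRing A] [Module Φ A]

/-- The class of a partial multiplier. -/
def mk (p : PartialMultiplier Φ A) : SymmetricQuotients Φ A := Quotient.mk _ p

theorem exists_mk (q : SymmetricQuotients Φ A) : ∃ p, mk p = q := Quotient.exists_rep q

variable [IsScalarTower Φ A A] [SMulCommClass Φ A A] [SemiprimeAlgebra Φ A]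

variable (Φ A) in
theorem incl_injective : Function.Injective (incl Φ A) := by
  intro a b hab
  have hD : IsDenseIdeal (⊤ : Submodule Φ A) := isDenseIdeal_top
  refine sub_eq_zero.1 (hD.eq_zero_of_mul_left _ fun x _ => ?_)
  rw [sub_mul, sub_eq_zero]
  exact (Quotient.exact hab x trivial trivial).1

/-- Inside `Q_s(A)` the map `left` becomes multiplication by the class of `p`. The left components
agree by `left_mul`, the right ones by `balanced`. -/
theorem mk_mul_incl (p : PartialMultiplier Φ A) (x : p.dom) :
    mk p * incl Φ A x = incl Φ A (p.left x) :=
  Quotient.sound fun y hy _ => ⟨p.left_mul x y, (p.balanced ⟨y, hy.1⟩ x).symm⟩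

theorem incl_mul_mk (p : PartialMultiplier Φ A) (x : p.dom) :
    incl Φ A x * mk p = incl Φ A (p.right x) :=
  Quotient.sound fun y hy _ => ⟨p.balanced x ⟨y, hy.2.1⟩, p.right_mul y x⟩

theorem mk_eq_zero (p : PartialMultiplier Φ A) (hl : ∀ x, p.left x = 0) (hr : ∀ x, p.right x = 0) :
    mk p = 0 :=
  Quotient.sound fun x hx _ => ⟨(hl ⟨x, hx⟩).trans (zero_mul x).symm,
    (hr ⟨x, hx⟩).trans (mul_zero x).symm⟩

theorem eq_zero_of_mul_left {I : Submodule Φ A} (hI : IsDenseIdeal I) {q : SymmetricQuotients Φ A}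
    (hq : ∀ x ∈ I, q * incl Φ A x = 0) : q = 0 := by
  obtain ⟨p, rfl⟩ := exists_mk q
  have hJ := p.dense.inf hI
  have h0 : ∀ (x : A) (hx : x ∈ p.dom ⊓ I), p.left ⟨x, hx.1⟩ = 0 := fun x hx => by
    have := hq x hx.2
    rw [mk_mul_incl p ⟨x, hx.1⟩] at this
    exact incl_injective Φ A (this.trans (map_zero _).symm)
  refine mk_eq_zero p (fun y => ?_) fun y => ?_
  · refine hJ.eq_zero_of_mul_left _ fun x hx => ?_
    rw [← p.left_mul]
    exact h0 _ (hJ.mul_mem_left _ hx)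
  -- Balancedness transfers the vanishing to the other map: `(y q) x = y (q x) = 0`.
  · refine hJ.eq_zero_of_mul_left _ fun x hx => ?_
    rw [← p.balanced y ⟨x, hx.1⟩, h0 x hx, mul_zero]

theorem eq_zero_of_mul_right {I : Submodule Φ A} (hI : IsDenseIdeal I)
    {q : SymmetricQuotients Φ A} (hq : ∀ x ∈ I, incl Φ A x * q = 0) : q = 0 := by
  obtain ⟨p, rfl⟩ := exists_mk q
  have hJ := p.dense.inf hI
  have h0 : ∀ (x : A) (hx : x ∈ p.dom ⊓ I), p.right ⟨x, hx.1⟩ = 0 := fun x hx => by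
    have := hq x hx.2
    rw [incl_mul_mk p ⟨x, hx.1⟩] at this
    exact incl_injective Φ A (this.trans (map_zero _).symm)
  refine mk_eq_zero p (fun y => ?_) fun y => ?_
  · refine hJ.eq_zero_of_mul_right _ fun x hx => ?_
    rw [p.balanced ⟨x, hx.1⟩ y, h0 x hx, zero_mul]
  · refine hJ.eq_zero_of_mul_right _ fun x hx => ?_
    rw [← p.right_mul]
    exact h0 _ (hJ.mul_mem_right _ hx)

/-- The inclusion of `A` into a subalgebra of `Q_s(A)`. -/
def inclSubalgebra (Q : NonUnitalSubalgebra Φ (SymmetricQuotients Φ A))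
    (hAQ : ∀ a : A, incl Φ A a ∈ Q) : A →ₙₐ[Φ] Q :=
  NonUnitalAlgHom.codRestrict (incl Φ A) Q hAQ

theorem hasDenseDenominators (Q : NonUnitalSubalgebra Φ (SymmetricQuotients Φ A))
    (hAQ : ∀ a : A, incl Φ A a ∈ Q) : HasDenseDenominators (inclSubalgebra Q hAQ) where
  injective a b hab := incl_injective Φ A (congrArg Subtype.val hab)
  exists_dense := by
    rintro ⟨q, hq⟩
    obtain ⟨p, rfl⟩ := exists_mk q
    exact ⟨p.dom, p.dense, fun x hx => ⟨p.left ⟨x, hx⟩, Subtype.ext (mk_mul_incl p ⟨x, hx⟩).symm⟩,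
      fun x hx => ⟨p.right ⟨x, hx⟩, Subtype.ext (incl_mul_mk p ⟨x, hx⟩).symm⟩⟩
  eq_zero_of_mul_left I hI q hq :=
    Subtype.ext (eq_zero_of_mul_left hI fun x hx => congrArg Subtype.val (hq x hx))
  eq_zero_of_mul_right I hI q hq :=
    Subtype.ext (eq_zero_of_mul_right hI fun x hx => congrArg Subtype.val (hq x hx))

end SymmetricQuotients

/-! ### Graded modules -/

section GradedModule

open DirectSum

variable {G : Type*} [DecidableEq G] {Φ : Type*} [CommRing Φ]
  {L : Type*} [AddCommGroup L] [Module Φ L] {M : Type*} [AddCommGroup M] [Module Φ M]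
  {𝓛 : G → Submodule Φ L} {𝓜 : G → Submodule Φ M}

/-- The projection onto a homogeneous component of a graded module. -/
noncomputable def gradedProj (h : IsInternal 𝓛) (σ : G) : L →ₗ[Φ] L :=
  (𝓛 σ).subtype ∘ₗ DirectSum.component Φ G (fun σ => 𝓛 σ) σ ∘ₗ
    (LinearEquiv.ofBijective (DirectSum.coeLinearMap 𝓛) h).symm.toLinearMap

theorem gradedProj_mem (h : IsInternal 𝓛) (σ : G) (x : L) : gradedProj h σ x ∈ 𝓛 σ :=
  Subtype.mem _

theorem gradedProj_apply_of_mem (h : IsInternal 𝓛) {σ τ : G} {x : L} (hx : x ∈ 𝓛 τ) :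
    gradedProj h σ x = if τ = σ then x else 0 := by
  have e : (LinearEquiv.ofBijective (DirectSum.coeLinearMap 𝓛) h).symm x =
      DirectSum.lof Φ G (fun σ => 𝓛 σ) τ ⟨x, hx⟩ := by
    rw [LinearEquiv.symm_apply_eq]
    exact (DirectSum.coeLinearMap_lof 𝓛 τ ⟨x, hx⟩).symm
  simp only [gradedProj, LinearMap.comp_apply, LinearEquiv.coe_coe, e, Submodule.subtype_apply]
  split_ifs with hτ
  · subst hτ
    rw [DirectSum.component.lof_self]
  · rw [DirectSum.component.of, dif_neg hτ, Submodule.coe_zero]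

theorem gradedProj_self (h : IsInternal 𝓛) {σ : G} {x : L} (hx : x ∈ 𝓛 σ) :
    gradedProj h σ x = x := by
  rw [gradedProj_apply_of_mem h hx, if_pos rfl]

theorem gradedProj_of_ne (h : IsInternal 𝓛) {σ τ : G} (hne : τ ≠ σ) {x : L} (hx : x ∈ 𝓛 τ) :
    gradedProj h σ x = 0 := by
  rw [gradedProj_apply_of_mem h hx, if_neg hne]

theorem mem_of_gradedProj_mem (h : IsInternal 𝓛) {N : Submodule Φ L} {x : L}
    (hx : ∀ σ, gradedProj h σ x ∈ N) : x ∈ N := by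
  obtain ⟨y, rfl⟩ := (LinearEquiv.ofBijective (DirectSum.coeLinearMap 𝓛) h).surjective x
  have e : ∀ σ, gradedProj h σ (LinearEquiv.ofBijective (DirectSum.coeLinearMap 𝓛) h y) = y σ := by
    intro σ
    simp only [gradedProj, LinearMap.comp_apply, LinearEquiv.coe_coe, LinearEquiv.symm_apply_apply,
      Submodule.subtype_apply]
    rfl
  classical
  change DirectSum.coeLinearMap 𝓛 y ∈ N
  rw [DirectSum.coeLinearMap_eq_dfinsuppSum 𝓛 y]
  exact N.dfinsuppSum_mem _ _ fun σ _ => e σ ▸ hx σ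

/-- A submodule containing all homogeneous elements is everything. -/
theorem mem_of_forall_homogeneous (h : IsInternal 𝓛) {N : Submodule Φ L}
    (hN : ∀ σ, ∀ x ∈ 𝓛 σ, x ∈ N) (x : L) : x ∈ N :=
  mem_of_gradedProj_mem h fun σ => hN σ _ (gradedProj_mem h σ x)

/-- Homogeneous linear maps commute with the projections. -/
theorem gradedProj_map (h𝓛 : IsInternal 𝓛) (h𝓜 : IsInternal 𝓜) (T : L →ₗ[Φ] M) {e : G → G}
    (he : Function.Injective e) (hT : ∀ σ, ∀ x ∈ 𝓛 σ, T x ∈ 𝓜 (e σ)) (σ : G) (x : L) :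
    gradedProj h𝓜 (e σ) (T x) = T (gradedProj h𝓛 σ x) := by
  have := mem_of_forall_homogeneous h𝓛
    (N := LinearMap.eqLocus (gradedProj h𝓜 (e σ) ∘ₗ T) (T ∘ₗ gradedProj h𝓛 σ)) ?_ x
  · exact this
  · intro τ y hy
    rw [LinearMap.mem_eqLocus, LinearMap.comp_apply, LinearMap.comp_apply]
    by_cases hτ : τ = σ
    · subst hτ
      rw [gradedProj_self h𝓛 hy, gradedProj_self h𝓜 (hT _ y hy)]
    · rw [gradedProj_of_ne h𝓛 hτ hy, gradedProj_of_ne h𝓜 (he.ne hτ) (hT _ y hy), map_zero]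

/-- The `π σ` act as coordinates. Their codomain is left free so that projections of an ambient
module, restricted to a submodule, can be used. -/
theorem isInternal_of_projections (π : G → L →ₗ[Φ] M)
    (hπ : ∀ σ, ∀ x ∈ 𝓛 σ, π σ x = 0 → x = 0) (hπ' : ∀ σ τ, τ ≠ σ → ∀ x ∈ 𝓛 τ, π σ x = 0)
    (htop : iSup 𝓛 = ⊤) : IsInternal 𝓛 := by
  rw [DirectSum.isInternal_submodule_iff_iSupIndep_and_iSup_eq_top]
  refine ⟨iSupIndep_def.2 fun σ => Submodule.disjoint_def.2 fun x hx hx' => hπ σ x hx ?_, htop⟩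
  have : ⨆ τ, ⨆ (_ : τ ≠ σ), 𝓛 τ ≤ LinearMap.ker (π σ) :=
    iSup_le fun τ => iSup_le fun hτ x hx => hπ' σ τ hτ x hx
  exact this hx'

theorem DirectSum.IsInternal.iSup_eq_top (h : IsInternal 𝓛) : iSup 𝓛 = ⊤ :=
  ((DirectSum.isInternal_submodule_iff_iSupIndep_and_iSup_eq_top 𝓛).1 h).2

/-- The grading induced on the quotient by a homogeneous submodule. -/
theorem isInternal_map (h : IsInternal 𝓛) (f : L →ₗ[Φ] M) (hf : Function.Surjective f)
    (hker : ∀ σ, ∀ x, f x = 0 → f (gradedProj h σ x) = 0) :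
    IsInternal fun σ => (𝓛 σ).map f := by
  obtain ⟨π, hπ⟩ : ∃ π : G → M →ₗ[Φ] M, ∀ σ x, π σ (f x) = f (gradedProj h σ x) := by
    have : ∀ σ, LinearMap.ker f ≤ LinearMap.ker (f ∘ₗ gradedProj h σ) := fun σ x hx => hker σ x hx
    refine ⟨fun σ => (LinearMap.ker f).liftQ (f ∘ₗ gradedProj h σ) (this σ) ∘ₗ
      (f.quotKerEquivOfSurjective hf).symm.toLinearMap, fun σ x => ?_⟩
    have e : (f.quotKerEquivOfSurjective hf).symm (f x) = (LinearMap.ker f).mkQ x := by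
      rw [LinearEquiv.symm_apply_eq]
      rfl
    rw [LinearMap.comp_apply, LinearEquiv.coe_coe, e]
    rfl
  refine isInternal_of_projections π ?_ ?_ ?_
  · rintro σ _ ⟨x, hx, rfl⟩ h0
    rwa [hπ, gradedProj_self h hx] at h0
  · rintro σ τ hτ _ ⟨x, hx, rfl⟩
    rw [hπ, gradedProj_of_ne h hτ hx, map_zero]
  · rw [← Submodule.map_iSup, h.iSup_eq_top, Submodule.map_top, LinearMap.range_eq_top.2 hf]

/-- The grading induced on a homogeneous submodule. -/
theorem isInternal_comap_subtype (h : IsInternal 𝓛) (N : Submodule Φ L)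
    (hN : ∀ σ, ∀ x ∈ N, gradedProj h σ x ∈ N) :
    IsInternal fun σ => (𝓛 σ).comap N.subtype := by
  refine isInternal_of_projections (fun σ => gradedProj h σ ∘ₗ N.subtype) ?_ ?_ ?_
  · intro σ x hx h0
    rw [LinearMap.comp_apply, gradedProj_self h hx] at h0
    exact Subtype.ext h0
  · intro σ τ hτ x hx
    exact gradedProj_of_ne h hτ hx
  · refine eq_top_iff.2 fun x _ => ?_
    have : (x : L) ∈ (⨆ σ, (𝓛 σ).comap N.subtype).map N.subtype :=
      mem_of_gradedProj_mem h fun σ => ⟨⟨gradedProj h σ x, hN σ x x.2⟩,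
        Submodule.mem_iSup_of_mem σ (gradedProj_mem h σ x), rfl⟩
    obtain ⟨y, hy, e⟩ := this
    rwa [← Subtype.ext e]

end GradedModule

/-! ### Graded Lie algebras -/

section GradedLie

open DirectSum

variable {G : Type*} [AddCommGroup G] [DecidableEq G] {Φ : Type*} [CommRing Φ]
  {L M : Type*} [LieRing L] [LieAlgebra Φ L] [LieRing M] [LieAlgebra Φ M]
  {𝓛 : G → Submodule Φ L} {𝓜 : G → Submodule Φ M}

namespace IsLieGrading

theorem gradedProj_lie (h : IsLieGrading 𝓛) {τ : G} {y : L} (hy : y ∈ 𝓛 τ) (σ : G) (x : L) :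
    gradedProj h.isInternal (τ + σ) ⁅y, x⁆ = ⁅y, gradedProj h.isInternal σ x⁆ :=
  gradedProj_map h.isInternal h.isInternal (LieAlgebra.ad Φ L y : L →ₗ[Φ] L)
    (add_right_injective τ) (fun _ _ hx => h.graded.bracket_mem hy hx) σ x

/-- For `z` of degree `τ`, `[z, x_σ]` is the component of `[z, x] = 0` in degree `τ + σ`;
homogeneous `z` suffice. -/
theorem gradedProj_mem_center (h : IsLieGrading 𝓛) (σ : G) {x : L}
    (hx : x ∈ LieAlgebra.center Φ L) : gradedProj h.isInternal σ x ∈ LieAlgebra.center Φ L := by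
  rw [LieModule.mem_maxTrivSubmodule] at hx ⊢
  intro y
  have := mem_of_forall_homogeneous h.isInternal
    (N := LinearMap.ker (LieAlgebra.ad Φ L (gradedProj h.isInternal σ x) : L →ₗ[Φ] L)) ?_ y
  · rw [← lie_skew, neg_eq_zero]
    exact this
  · intro τ z hz
    rw [LinearMap.mem_ker, LieAlgebra.ad_apply, ← lie_skew, ← h.gradedProj_lie hz, hx, map_zero,
      neg_zero]

theorem gradedProj_mem_derivedIdeal (h : IsLieGrading 𝓛) (σ : G) {x : L}
    (hx : x ∈ derivedIdeal Φ L) : gradedProj h.isInternal σ x ∈ derivedIdeal Φ L := by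
  have hle : (derivedIdeal Φ L).toSubmodule ≤
      (derivedIdeal Φ L).toSubmodule.comap (gradedProj h.isInternal σ) := by
    rw [LieSubmodule.lieIdeal_oper_eq_linear_span', Submodule.span_le]
    rintro _ ⟨a, -, b, -, rfl⟩
    rw [← LieSubmodule.lieIdeal_oper_eq_linear_span']
    -- Decomposing `a` suffices: for `y` of degree `τ`, the `σ`-component of `[y, b]` is `[y,
    -- b_{σ-τ}]`, again a bracket.
    have H := mem_of_forall_homogeneous h.isInternal
      (N := (derivedIdeal Φ L).toSubmodule.comap
        (gradedProj h.isInternal σ ∘ₗ (LieAlgebra.ad Φ L b : L →ₗ[Φ] L))) (fun τ y hy => by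
          rw [Submodule.mem_comap, LinearMap.comp_apply, LieAlgebra.ad_apply, ← lie_skew, map_neg,
            ← add_sub_cancel τ σ, h.gradedProj_lie hy]
          exact neg_mem (LieSubmodule.lie_mem_lie (LieSubmodule.mem_top _)
            (LieSubmodule.mem_top _))) a
    rw [Submodule.mem_comap, LinearMap.comp_apply, LieAlgebra.ad_apply, ← lie_skew, map_neg] at H
    rwa [neg_mem_iff] at H
  exact hle hx

theorem derivedGrading (h : IsLieGrading 𝓛) : IsLieGrading (derivedGrading 𝓛) where
  isInternal := isInternal_comap_subtype h.isInternal (derivedIdeal Φ L).toSubmodule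
    fun σ _ hx => h.gradedProj_mem_derivedIdeal σ hx
  graded := ⟨fun _ _ _ _ hx hy => h.graded.bracket_mem hx hy⟩

theorem modCenterGrading (h : IsLieGrading 𝓛) : IsLieGrading (modCenterGrading 𝓛) where
  isInternal := by
    refine isInternal_map h.isInternal (toModCenter Φ L)
      (LieSubmodule.Quotient.surjective_mk' _) fun σ x hx => ?_
    exact (LieSubmodule.Quotient.mk_eq_zero' ).2 (h.gradedProj_mem_center σ
      ((LieSubmodule.Quotient.mk_eq_zero').1 hx))
  graded := by
    refine ⟨?_⟩
    rintro _ _ _ _ ⟨x, hx, rfl⟩ ⟨y, hy, rfl⟩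
    exact ⟨⁅x, y⁆, h.graded.bracket_mem hx hy, LieSubmodule.Quotient.mk_bracket _ x y⟩

end IsLieGrading

theorem toModCenter_eq_zero {x : L} : toModCenter Φ L x = 0 ↔ x ∈ LieAlgebra.center Φ L :=
  LieSubmodule.Quotient.mk_eq_zero'

theorem toModCenter_surjective : Function.Surjective (toModCenter Φ L) :=
  LieSubmodule.Quotient.surjective_mk' _

theorem toModCenter_lie (x y : L) :
    toModCenter Φ L ⁅x, y⁆ = ⁅toModCenter Φ L x, toModCenter Φ L y⁆ :=
  LieSubmodule.Quotient.mk_bracket _ x y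

/-- The homomorphism induced on the quotients by the centers. -/
def modCenterMap (φ : L →ₗ⁅Φ⁆ M) (hφ : ∀ x ∈ LieAlgebra.center Φ L, φ x ∈ LieAlgebra.center Φ M) :
    ModCenter Φ L →ₗ⁅Φ⁆ ModCenter Φ M where
  toLinearMap := Submodule.mapQ (LieAlgebra.center Φ L).toSubmodule
    (LieAlgebra.center Φ M).toSubmodule (φ : L →ₗ[Φ] M) hφ
  map_lie' := by
    intro x y
    obtain ⟨x, rfl⟩ := toModCenter_surjective (Φ := Φ) x
    obtain ⟨y, rfl⟩ := toModCenter_surjective (Φ := Φ) y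
    refine (congrArg (toModCenter Φ M) (φ.map_lie x y)).trans (toModCenter_lie _ _)

theorem modCenterMap_apply (φ : L →ₗ⁅Φ⁆ M)
    (hφ : ∀ x ∈ LieAlgebra.center Φ L, φ x ∈ LieAlgebra.center Φ M) (x : L) :
    modCenterMap φ hφ (toModCenter Φ L x) = toModCenter Φ M (φ x) :=
  rfl

/-- A Lie ideal whose brackets with `q` lie in `L` has all its brackets with the span of the
elements `ad x₁ ⋯ ad xₙ q` in `L`. -/
theorem lie_adSpan_mem_range (f : L →ₗ⁅Φ⁆ M) {U : Set L} (hU : ∀ x ∈ U, ∀ y, ⁅x, y⁆ ∈ U) {q : M}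
    (hq : ∀ x ∈ U, ⁅f x, q⁆ ∈ f.range) {x : L} (hx : x ∈ U) {m : M} (hm : m ∈ adSpan f q) :
    ⁅f x, m⁆ ∈ f.range := by
  have hle : adSpan f q ≤ f.range.toSubmodule.comap (LieAlgebra.ad Φ M (f x) : M →ₗ[Φ] M) := by
    refine Submodule.span_le.2 ?_
    rintro _ ⟨l, rfl⟩
    change ⁅f x, _⁆ ∈ f.range
    induction l generalizing x with
    | nil => exact hq x hx
    | cons y l ih =>
      -- In `[x, [y, m]] = [[x, y], m] + [y, [x, m]]` the first term is covered by induction since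
      -- `[x, y] ∈ U`, the second since the range is a subalgebra.
      rw [List.foldr_cons, leibniz_lie, ← LieHom.map_lie]
      exact add_mem (ih (hU x hx y)) (f.range.lie_mem ⟨y, rfl⟩ (ih hx))
  exact hle hm

/-- Modulo centers, "nonzero" means "not central". The equivalence `hφ` makes the induced map both
well defined and injective, and asking for a stable set `U` leaves only brackets with `q` itself to
be checked. -/
theorem exists_isGradedAlgebraOfQuotients_modCenter (h𝓛 : IsLieGrading 𝓛) (h𝓜 : IsLieGrading 𝓜)
    (φ : L →ₗ⁅Φ⁆ M) (hφ : ∀ x, φ x ∈ LieAlgebra.center Φ M ↔ x ∈ LieAlgebra.center Φ L)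
    (hmap : ∀ σ, ∀ x ∈ 𝓛 σ, φ x ∈ 𝓜 σ)
    (habs : ∀ σ τ, ∀ p ∈ 𝓜 σ, p ∉ LieAlgebra.center Φ M → ∀ q ∈ 𝓜 τ, ∃ U : Set L,
      (∀ x ∈ U, ∀ y, ⁅x, y⁆ ∈ U) ∧ (∀ x ∈ U, ⁅φ x, q⁆ ∈ φ.range) ∧
        ∃ α, ∃ x ∈ U, x ∈ 𝓛 α ∧ ⁅φ x, p⁆ ∉ LieAlgebra.center Φ M) :
    ∃ f : ModCenter Φ L →ₗ⁅Φ⁆ ModCenter Φ M,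
      (∀ x, f (toModCenter Φ L x) = toModCenter Φ M (φ x)) ∧
        IsGradedAlgebraOfQuotients (modCenterGrading 𝓛) (modCenterGrading 𝓜) f := by
  refine ⟨modCenterMap φ fun x => (hφ x).2, fun _ => rfl, h𝓛.modCenterGrading,
    h𝓜.modCenterGrading, ?_, ?_, ?_⟩
  · rw [injective_iff_map_eq_zero]
    intro x hx
    obtain ⟨x, rfl⟩ := toModCenter_surjective (Φ := Φ) x
    rw [modCenterMap_apply, toModCenter_eq_zero, hφ] at hx
    exact toModCenter_eq_zero.2 hx
  · rintro σ _ ⟨x, hx, rfl⟩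
    exact ⟨φ x, hmap σ x hx, rfl⟩
  · rintro σ τ _ ⟨p, hp, rfl⟩ hp0 _ ⟨q, hq, rfl⟩
    obtain ⟨U, hU, hUq, α, x, hxU, hxα, hxp⟩ :=
      habs σ τ p hp (fun h => hp0 (toModCenter_eq_zero.2 h)) q hq
    refine ⟨α, toModCenter Φ L x, ⟨x, hxα, rfl⟩, ?_, fun m hm => ?_⟩
    · rw [modCenterMap_apply, ← toModCenter_lie, Ne, toModCenter_eq_zero]
      exact hxp
    · refine lie_adSpan_mem_range _ (U := toModCenter Φ L '' U) ?_ ?_ ⟨x, hxU, rfl⟩ hm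
      · rintro _ ⟨y, hy, rfl⟩ z
        obtain ⟨z, rfl⟩ := toModCenter_surjective (Φ := Φ) z
        exact ⟨_, hU y hy z, toModCenter_lie _ _⟩
      · rintro _ ⟨y, hy, rfl⟩
        obtain ⟨z, hz⟩ := hUq y hy
        refine ⟨toModCenter Φ L z, ?_⟩
        rw [modCenterMap_apply, ← toModCenter_lie, ← hz]
        rfl

end GradedLie

/-! ### Homogeneous denominators -/

section GradedDenominators

open DirectSum

variable {Φ : Type*} [CommRing Φ] {G : Type*} [AddCommGroup G] [DecidableEq G]
  {A : Type*} [NonUnitalRing A] [Module Φ A] [IsScalarTower Φ A A] [SMulCommClass Φ A A]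
  {Q : Type*} [NonUnitalRing Q] [Module Φ Q] [IsScalarTower Φ Q Q] [SMulCommClass Φ Q Q]
  {𝒜 : G → Submodule Φ A} {𝒬 : G → Submodule Φ Q}

/-- The graded submodule generated by a submodule. -/
noncomputable def gradedHull (h𝒜 : IsInternal 𝒜) (I : Submodule Φ A) : Submodule Φ A :=
  Submodule.span Φ {z | ∃ σ, ∃ x ∈ I, z = gradedProj h𝒜 σ x}

omit [AddCommGroup G] [IsScalarTower Φ A A] [SMulCommClass Φ A A] in
theorem le_gradedHull (h𝒜 : IsInternal 𝒜) (I : Submodule Φ A) : I ≤ gradedHull h𝒜 I :=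
  fun x hx => mem_of_gradedProj_mem h𝒜 fun σ => Submodule.subset_span ⟨σ, x, hx, rfl⟩

omit [IsScalarTower Φ A A] in
theorem gradedProj_mul_left (h𝒜 : IsInternal 𝒜) (hmul : SetLike.GradedMul 𝒜) {τ : G} {a : A}
    (ha : a ∈ 𝒜 τ) (σ : G) (x : A) :
    gradedProj h𝒜 (τ + σ) (a * x) = a * gradedProj h𝒜 σ x :=
  gradedProj_map h𝒜 h𝒜 (LinearMap.mulLeft Φ a) (add_right_injective τ)
    (fun _ _ hx => hmul.mul_mem ha hx) σ x

omit [SMulCommClass Φ A A] in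
theorem gradedProj_mul_right (h𝒜 : IsInternal 𝒜) (hmul : SetLike.GradedMul 𝒜) {τ : G} {a : A}
    (ha : a ∈ 𝒜 τ) (σ : G) (x : A) :
    gradedProj h𝒜 (σ + τ) (x * a) = gradedProj h𝒜 σ x * a :=
  gradedProj_map h𝒜 h𝒜 (LinearMap.mulRight Φ a) (add_left_injective τ)
    (fun _ _ hx => hmul.mul_mem hx ha) σ x

/-- For `b` of degree `τ`, `b x_σ` is the component of `b x ∈ I` in degree `τ + σ`, so the hull is
an ideal. It contains `I`, hence has no annihilators. -/
theorem IsDenseIdeal.gradedHull (h𝒜 : IsInternal 𝒜) (hmul : SetLike.GradedMul 𝒜)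
    {I : Submodule Φ A} (hI : IsDenseIdeal I) : IsDenseIdeal (gradedHull h𝒜 I) where
  toIsTwoSidedIdeal := by
    refine IsTwoSidedIdeal.span ?_ ?_
    · rintro a _ ⟨σ, x, hx, rfl⟩
      refine mem_of_forall_homogeneous h𝒜 (N := (_root_.gradedHull h𝒜 I).comap
        (LinearMap.mulRight Φ (gradedProj h𝒜 σ x))) (fun τ b hb => ?_) a
      exact Submodule.subset_span ⟨τ + σ, b * x, hI.mul_mem_left b hx,
        (gradedProj_mul_left h𝒜 hmul hb σ x).symm⟩
    · rintro a _ ⟨σ, x, hx, rfl⟩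
      refine mem_of_forall_homogeneous h𝒜 (N := (_root_.gradedHull h𝒜 I).comap
        (LinearMap.mulLeft Φ (gradedProj h𝒜 σ x))) (fun τ b hb => ?_) a
      exact Submodule.subset_span ⟨σ + τ, x * b, hI.mul_mem_right b hx,
        (gradedProj_mul_right h𝒜 hmul hb σ x).symm⟩
  eq_zero_of_mul_left z hz :=
    hI.eq_zero_of_mul_left z fun x hx => hz x (le_gradedHull h𝒜 I hx)
  eq_zero_of_mul_right z hz :=
    hI.eq_zero_of_mul_right z fun x hx => hz x (le_gradedHull h𝒜 I hx)

/-- The commutators of a homogeneous element `q` of `Q` with some dense ideal of `A` spanned by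
homogeneous elements all lie in `A`. -/
theorem HasDenseDenominators.exists_graded {ι : A →ₙₐ[Φ] Q} (h : HasDenseDenominators ι)
    (h𝒜 : IsInternal 𝒜) (hmul : SetLike.GradedMul 𝒜) (h𝒬 : IsInternal 𝒬)
    (hmulQ : SetLike.GradedMul 𝒬) (hι : ∀ σ, ∀ a ∈ 𝒜 σ, ι a ∈ 𝒬 σ) {τ : G} {q : Q}
    (hq : q ∈ 𝒬 τ) :
    ∃ I : Submodule Φ A, IsDenseIdeal I ∧
      I ≤ Submodule.span Φ {x | x ∈ I ∧ ∃ σ, x ∈ 𝒜 σ} ∧ ∀ x ∈ I, ∃ a, ι a = ⁅ι x, q⁆ := by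
  obtain ⟨I, hI, hl, hr⟩ := h.exists_dense q
  have eι : ∀ σ x, gradedProj h𝒬 σ (ι x) = ι (gradedProj h𝒜 σ x) :=
    gradedProj_map h𝒜 h𝒬 (ι : A →ₗ[Φ] Q) (e := id) Function.injective_id hι
  refine ⟨gradedHull h𝒜 I, hI.gradedHull h𝒜 hmul, Submodule.span_le.2 ?_, ?_⟩
  · rintro _ ⟨σ, x, hx, rfl⟩
    exact Submodule.subset_span ⟨Submodule.subset_span ⟨σ, x, hx, rfl⟩, σ, gradedProj_mem h𝒜 σ x⟩
  · have key : gradedHull h𝒜 I ≤ (LinearMap.range (ι : A →ₗ[Φ] Q)).comap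
        ((LinearMap.mulRight Φ q - LinearMap.mulLeft Φ q) ∘ₗ (ι : A →ₗ[Φ] Q)) := by
      refine Submodule.span_le.2 ?_
      rintro _ ⟨σ, x, hx, rfl⟩
      obtain ⟨a, ha⟩ := hl x hx
      obtain ⟨b, hb⟩ := hr x hx
      -- As `q` has degree `τ`, `x_σ q` and `q x_σ` are components of `x q` and `q x`. Those lie in
      -- `A`, and `ι` commutes with the projections.
      refine ⟨gradedProj h𝒜 (σ + τ) b - gradedProj h𝒜 (τ + σ) a, ?_⟩
      change ι _ = ι _ * q - q * ι _
      rw [map_sub, ← eι, ← eι, hb, ha, gradedProj_mul_left h𝒬 hmulQ hq,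
        gradedProj_mul_right h𝒬 hmulQ hq, eι]
    exact fun x hx => key hx

end GradedDenominators

/-! ### The Lie algebras `A⁻` and `[A, A]` -/

section MinusAlgebra

open DirectSum

variable {Φ : Type*} [CommRing Φ] {A : Type*} [NonUnitalRing A] [Module Φ A]
  [IsScalarTower Φ A A] [SMulCommClass Φ A A]
  {Q : Type*} [NonUnitalRing Q] [Module Φ Q] [IsScalarTower Φ Q Q] [SMulCommClass Φ Q Q]

theorem isLieGrading_minusGrading {G : Type*} [AddCommGroup G] [DecidableEq G]
    {𝒜 : G → Submodule Φ A} (h𝒜 : IsInternal 𝒜) (hmul : SetLike.GradedMul 𝒜) :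
    IsLieGrading (minusGrading 𝒜) where
  isInternal := by
    refine isInternal_map h𝒜 _ (MinusAlgebra.of Φ : A ≃ₗ[Φ] _).surjective fun σ x hx => ?_
    have : x = 0 := hx
    rw [this, map_zero, map_zero]
  graded := by
    refine ⟨?_⟩
    rintro σ τ _ _ ⟨x, hx, rfl⟩ ⟨y, hy, rfl⟩
    refine ⟨x * y - y * x, (𝒜 (σ + τ)).sub_mem (hmul.mul_mem hx hy) ?_, rfl⟩
    rw [add_comm]
    exact hmul.mul_mem hy hx

omit [IsScalarTower Φ A A] [SMulCommClass Φ A A] in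
theorem mem_minusGrading {G : Type*} {𝒜 : G → Submodule Φ A} {σ : G} {x : A} :
    (MinusAlgebra.of Φ x ∈ minusGrading 𝒜 σ) ↔ x ∈ 𝒜 σ :=
  ⟨fun ⟨y, hy, e⟩ => (show y = x from e) ▸ hy, fun h => ⟨x, h, rfl⟩⟩

theorem of_mem_center {x : A} :
    MinusAlgebra.of Φ x ∈ LieAlgebra.center Φ (MinusAlgebra A) ↔ ∀ z : A, ⁅x, z⁆ = 0 :=
  (LieModule.mem_maxTrivSubmodule ..).trans
    ⟨fun h z => ring_lie_eq_zero_symm (R := A) (h z),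
      fun h z => ring_lie_eq_zero_symm (R := A) (h z)⟩

/-- The homomorphism `A⁻ → Q⁻` given by a homomorphism `A → Q`. -/
def minusMap (ι : A →ₙₐ[Φ] Q) : MinusAlgebra A →ₗ⁅Φ⁆ MinusAlgebra Q where
  toLinearMap := (MinusAlgebra.of Φ : Q ≃ₗ[Φ] _).toLinearMap ∘ₗ (ι : A →ₗ[Φ] Q) ∘ₗ
    (MinusAlgebra.of Φ : A ≃ₗ[Φ] _).symm.toLinearMap
  map_lie' := fun {x y} => HasDenseDenominators.map_lie ι x y

/-- The homomorphism `[L, L] → [M, M]` given by a homomorphism `L → M`. -/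
def derivedMap {L M : Type*} [LieRing L] [LieAlgebra Φ L] [LieRing M] [LieAlgebra Φ M]
    (φ : L →ₗ⁅Φ⁆ M) : derivedIdeal Φ L →ₗ⁅Φ⁆ derivedIdeal Φ M where
  toLinearMap := (φ : L →ₗ[Φ] M).restrict
    (p := (derivedIdeal Φ L).toSubmodule) (q := (derivedIdeal Φ M).toSubmodule) <| by
      intro x hx
      have : (derivedIdeal Φ L).toSubmodule ≤
          (derivedIdeal Φ M).toSubmodule.comap (φ : L →ₗ[Φ] M) := by
        rw [LieSubmodule.lieIdeal_oper_eq_linear_span', Submodule.span_le]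
        rintro _ ⟨a, -, b, -, rfl⟩
        change φ ⁅a, b⁆ ∈ derivedIdeal Φ M
        rw [LieHom.map_lie]
        exact LieSubmodule.lie_mem_lie (LieSubmodule.mem_top _) (LieSubmodule.mem_top _)
      exact this hx
  map_lie' := fun {x y} => Subtype.ext (φ.map_lie x y)

end MinusAlgebra

/-! ### Comparison of centers, and the two quotient theorems. -/

section Main

open DirectSum

variable {Φ : Type*} [CommRing Φ] {G : Type*} [AddCommGroup G] [DecidableEq G]
  {A : Type*} [NonUnitalRing A] [Module Φ A] [IsScalarTower Φ A A] [SMulCommClass Φ A A]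
  [SemiprimeAlgebra Φ A]
  {Q : Type*} [NonUnitalRing Q] [Module Φ Q] [IsScalarTower Φ Q Q] [SMulCommClass Φ Q Q]
  {𝒜 : G → Submodule Φ A} {𝒬 : G → Submodule Φ Q}

namespace HasDenseDenominators

theorem lie_map_eq_zero_iff {ι : A →ₙₐ[Φ] Q} (h : HasDenseDenominators ι) {x : A} :
    (∀ z : Q, ⁅ι x, z⁆ = 0) ↔ ∀ z : A, ⁅x, z⁆ = 0 := by
  refine ⟨fun H z => h.injective ?_, fun H => h.lie_eq_zero_of_dense isDenseIdeal_top ?_⟩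
  · rw [map_lie, H, map_zero]
  · intro z _
    rw [← map_lie, H, map_zero]

theorem exists_modCenter_minus {ι : A →ₙₐ[Φ] Q} (h : HasDenseDenominators ι)
    (h𝒜 : IsInternal 𝒜) (hmul : SetLike.GradedMul 𝒜) (h𝒬 : IsInternal 𝒬)
    (hmulQ : SetLike.GradedMul 𝒬) (hι : ∀ σ, ∀ a ∈ 𝒜 σ, ι a ∈ 𝒬 σ) :
    ∃ f : ModCenter Φ (MinusAlgebra A) →ₗ⁅Φ⁆ ModCenter Φ (MinusAlgebra Q),
      (∀ x, f (toModCenter Φ _ x) = toModCenter Φ _ (minusMap ι x)) ∧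
      IsGradedAlgebraOfQuotients (modCenterGrading (minusGrading 𝒜))
        (modCenterGrading (minusGrading 𝒬)) f := by
  refine exists_isGradedAlgebraOfQuotients_modCenter (isLieGrading_minusGrading h𝒜 hmul)
    (isLieGrading_minusGrading h𝒬 hmulQ) _ (fun x => ?_) ?_ ?_
  · exact of_mem_center.trans (h.lie_map_eq_zero_iff.trans of_mem_center.symm)
  · rintro σ _ ⟨x, hx, rfl⟩
    exact ⟨ι x, hι σ x hx, rfl⟩
  rintro σ τ _ ⟨p, hp, rfl⟩ hpc _ ⟨q, hq, rfl⟩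
  obtain ⟨I, hI, hgen, hIq⟩ := h.exists_graded h𝒜 hmul h𝒬 hmulQ hι hq
  refine ⟨(I : Set A), fun x hx y => ?_, fun x hx => hIq x hx, ?_⟩
  · exact I.sub_mem (hI.mul_mem_right y hx) (hI.mul_mem_left y hx)
  -- If no homogeneous element of `I` works, then `[p, I]` is central, because `I` is spanned by its
  -- homogeneous elements.
  by_contra! hcon
  refine hpc (of_mem_center.2 (h.lie_eq_zero_of_lie_central hI fun x hx => ?_))
  have key : I ≤ (LieAlgebra.center Φ (MinusAlgebra Q)).toSubmodule.comap
      (LieAlgebra.ad Φ (MinusAlgebra Q) (MinusAlgebra.of Φ p) ∘ₗ (minusMap ι).toLinearMap) := by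
    refine hgen.trans (Submodule.span_le.2 ?_)
    rintro y ⟨hy, α, hyα⟩
    have := neg_mem (hcon α y hy ⟨y, hyα, rfl⟩)
    rwa [lie_skew] at this
  exact (of_mem_center (Φ := Φ)).1 (key hx)

/-- Commuting with `[A, A]` alone already forces centrality in `Q`, with no torsion assumption.
Taking `ι` to be the identity gives the same for `[A, A]`. -/
theorem mem_center_derivedIdeal {ι : A →ₙₐ[Φ] Q} (h : HasDenseDenominators ι)
    {p : derivedIdeal Φ (MinusAlgebra Q)} :
    p ∈ LieAlgebra.center Φ (derivedIdeal Φ (MinusAlgebra Q)) ↔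
      (p : MinusAlgebra Q) ∈ LieAlgebra.center Φ (MinusAlgebra Q) := by
  constructor
  · intro H
    rw [LieModule.mem_maxTrivSubmodule] at H
    refine (of_mem_center (Φ := Φ) (A := Q)).2
      (h.lie_eq_zero_of_lie_lie_eq_zero isDenseIdeal_top fun x _ y _ => ?_)
    have hxy : (⁅MinusAlgebra.of Φ (ι x), MinusAlgebra.of Φ (ι y)⁆ : MinusAlgebra Q) ∈
        derivedIdeal Φ (MinusAlgebra Q) :=
      LieSubmodule.lie_mem_lie (LieSubmodule.mem_top _) (LieSubmodule.mem_top _)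
    exact ring_lie_eq_zero_symm (R := Q) (congrArg Subtype.val (H ⟨_, hxy⟩))
  · intro H
    rw [LieModule.mem_maxTrivSubmodule] at H ⊢
    exact fun z => Subtype.ext (H z)

end HasDenseDenominators

theorem HasDenseDenominators.id : HasDenseDenominators (NonUnitalAlgHom.id Φ A) where
  injective := Function.injective_id
  exists_dense q := ⟨⊤, isDenseIdeal_top, fun x _ => ⟨q * x, rfl⟩, fun x _ => ⟨x * q, rfl⟩⟩
  eq_zero_of_mul_left _ hI q hq := hI.eq_zero_of_mul_left q hq
  eq_zero_of_mul_right _ hI q hq := hI.eq_zero_of_mul_right q hq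

namespace HasDenseDenominators

theorem exists_modCenter_derived {ι : A →ₙₐ[Φ] Q} (h : HasDenseDenominators ι)
    (h2 : ∀ a : A, a + a = 0 → a = 0)
    (h𝒜 : IsInternal 𝒜) (hmul : SetLike.GradedMul 𝒜) (h𝒬 : IsInternal 𝒬)
    (hmulQ : SetLike.GradedMul 𝒬) (hι : ∀ σ, ∀ a ∈ 𝒜 σ, ι a ∈ 𝒬 σ) :
    ∃ f : ModCenter Φ (derivedIdeal Φ (MinusAlgebra A)) →ₗ⁅Φ⁆
        ModCenter Φ (derivedIdeal Φ (MinusAlgebra Q)),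
      (∀ x, f (toModCenter Φ _ x) = toModCenter Φ _ (derivedMap (minusMap ι) x)) ∧
      IsGradedAlgebraOfQuotients (modCenterGrading (derivedGrading (minusGrading 𝒜)))
        (modCenterGrading (derivedGrading (minusGrading 𝒬))) f := by
  refine exists_isGradedAlgebraOfQuotients_modCenter
    (isLieGrading_minusGrading h𝒜 hmul).derivedGrading
    (isLieGrading_minusGrading h𝒬 hmulQ).derivedGrading _ (fun x => ?_) ?_ ?_
  · exact h.mem_center_derivedIdeal.trans (of_mem_center.trans (h.lie_map_eq_zero_iff.trans
      (of_mem_center.symm.trans HasDenseDenominators.id.mem_center_derivedIdeal.symm)))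
  · rintro σ ⟨_, _⟩ ⟨x, hx, rfl⟩
    exact ⟨ι x, hι σ x hx, rfl⟩
  rintro σ τ ⟨_, hpd⟩ ⟨p, hp, rfl⟩ hpc ⟨_, hqd⟩ ⟨q, hq, rfl⟩
  obtain ⟨I, hI, hgen, hIq⟩ := h.exists_graded h𝒜 hmul h𝒬 hmulQ hι hq
  -- The span `[I, I]` is used because brackets with `q` must land in `[A, A]`, not only in `A`:
  -- `[q, [a, b]] = [b, [a, q]] - [a, [b, q]]`, where `[a, q]` and `[b, q]` lie in `A`.
  let S : Submodule Φ (MinusAlgebra A) :=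
    Submodule.span Φ {u | ∃ a ∈ I, ∃ b ∈ I, u = ⁅MinusAlgebra.of Φ a, MinusAlgebra.of Φ b⁆}
  have hlie : ∀ a ∈ I, ∀ y : A, ⁅a, y⁆ ∈ I := fun a ha y =>
    I.sub_mem (hI.mul_mem_right y ha) (hI.mul_mem_left y ha)
  have hS : ∀ a ∈ I, ∀ b ∈ I, ⁅MinusAlgebra.of Φ a, MinusAlgebra.of Φ b⁆ ∈ S :=
    fun a ha b hb => Submodule.subset_span ⟨a, ha, b, hb, rfl⟩
  refine ⟨{u | (u : MinusAlgebra A) ∈ S}, fun x hx y => ?_, fun x hx => ?_, ?_⟩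
  · have key : S ≤ S.comap (LieAlgebra.ad Φ (MinusAlgebra A) (y : MinusAlgebra A)) := by
      refine Submodule.span_le.2 ?_
      rintro _ ⟨a, ha, b, hb, rfl⟩
      rw [SetLike.mem_coe, Submodule.mem_comap, LieAlgebra.ad_apply, ← lie_skew, lie_lie, neg_sub]
      exact S.sub_mem (hS b hb _ (hlie a ha (y : MinusAlgebra A)))
        (hS a ha _ (hlie b hb (y : MinusAlgebra A)))
    have : -⁅(y : MinusAlgebra A), (x : MinusAlgebra A)⁆ ∈ S := S.neg_mem (key hx)
    rwa [lie_skew] at this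
  · have key : S ≤ ((derivedIdeal Φ (MinusAlgebra A)).toSubmodule.map
        (minusMap ι).toLinearMap).comap
          (LieAlgebra.ad Φ (MinusAlgebra Q) (MinusAlgebra.of Φ q) ∘ₗ
            (minusMap ι).toLinearMap) := by
      refine Submodule.span_le.2 ?_
      rintro _ ⟨a, ha, b, hb, rfl⟩
      obtain ⟨a', ea⟩ := hIq a ha
      obtain ⟨b', eb⟩ := hIq b hb
      refine ⟨⁅MinusAlgebra.of Φ b, MinusAlgebra.of Φ a'⁆ -
        ⁅MinusAlgebra.of Φ a, MinusAlgebra.of Φ b'⁆, sub_mem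
          (LieSubmodule.lie_mem_lie (LieSubmodule.mem_top _) (LieSubmodule.mem_top _))
          (LieSubmodule.lie_mem_lie (LieSubmodule.mem_top _) (LieSubmodule.mem_top _)), ?_⟩
      change ι (⁅b, a'⁆ - ⁅a, b'⁆) = ⁅q, ι ⁅a, b⁆⁆
      rw [map_sub, map_lie, map_lie, map_lie, ea, eb]
      simp only [Ring.lie_def, mul_sub, sub_mul, mul_assoc]
      abel
    obtain ⟨w, hw, e⟩ := key hx
    refine ⟨-⟨w, hw⟩, Subtype.ext ?_⟩
    change (minusMap ι) (-w) = ⁅minusMap ι x, MinusAlgebra.of Φ q⁆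
    rw [map_neg, ← lie_skew]
    exact congrArg Neg.neg e
  · by_contra! hcon
    refine hpc (h.mem_center_derivedIdeal.2 (of_mem_center.2
      (h.lie_eq_zero_of_lie_lie_central h2 hI fun x hx y hy => ?_)))
    let Z := (LieAlgebra.center Φ (MinusAlgebra Q)).toSubmodule
    let D := LieAlgebra.ad Φ (MinusAlgebra Q) (MinusAlgebra.of Φ p)
    -- The assumed failure concerns homogeneous elements only, such as `[x, y]` of degree `α + β`.
    -- Linearity in `y`, then in `x`, extends centrality of `[p, [x, y]]` to all of `I`.
    have base : ∀ x ∈ I, ∀ α, x ∈ 𝒜 α → ∀ y ∈ I, ∀ β, y ∈ 𝒜 β →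
        D ⁅minusMap ι x, minusMap ι y⁆ ∈ Z := by
      intro x hx α hxα y hy β hyβ
      have hd : (⁅MinusAlgebra.of Φ x, MinusAlgebra.of Φ y⁆ : MinusAlgebra A) ∈
          derivedIdeal Φ (MinusAlgebra A) :=
        LieSubmodule.lie_mem_lie (LieSubmodule.mem_top _) (LieSubmodule.mem_top _)
      have H := hcon (α + β) ⟨_, hd⟩ (Submodule.subset_span ⟨x, hx, y, hy, rfl⟩)
        ((isLieGrading_minusGrading h𝒜 hmul).graded.bracket_mem
          (mem_minusGrading.2 hxα) (mem_minusGrading.2 hyβ))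
      have := neg_mem (h.mem_center_derivedIdeal.1 H)
      change -⁅_, _⁆ ∈ Z at this
      rw [lie_skew] at this
      have e : minusMap ι ⁅MinusAlgebra.of Φ x, MinusAlgebra.of Φ y⁆ =
          ⁅minusMap ι (MinusAlgebra.of Φ x), minusMap ι (MinusAlgebra.of Φ y)⁆ :=
        LieHom.map_lie _ _ _
      exact (congrArg (D · ∈ Z) e).mp this
    have step : ∀ x ∈ I, ∀ α, x ∈ 𝒜 α → ∀ y ∈ I, D ⁅minusMap ι x, minusMap ι y⁆ ∈ Z := by
      intro x hx α hxα
      have key : I ≤ Z.comap (D ∘ₗ LieAlgebra.ad Φ (MinusAlgebra Q) (minusMap ι x) ∘ₗ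
          (minusMap ι).toLinearMap) := by
        refine hgen.trans (Submodule.span_le.2 ?_)
        rintro y ⟨hy, β, hyβ⟩
        exact base x hx α hxα y hy β hyβ
      exact fun y hy => key hy
    have key : I ≤ Z.comap (D ∘ₗ LieAlgebra.ad Φ (MinusAlgebra Q) (minusMap ι y) ∘ₗ
        (minusMap ι).toLinearMap) := by
      refine hgen.trans (Submodule.span_le.2 ?_)
      rintro x ⟨hx, α, hxα⟩
      have := neg_mem (step x hx α hxα y hy)
      rwa [← map_neg, lie_skew] at this
    have : -D ⁅minusMap ι y, minusMap ι x⁆ ∈ Z := Z.neg_mem (key hx)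
    rw [← map_neg, lie_skew] at this
    exact of_mem_center.1 this

end HasDenseDenominators

end Main

theorem mainTheorem8 {Φ : Type*} [CommRing Φ] {G : Type*} [AddCommGroup G] [DecidableEq G]
    {A : Type*} [NonUnitalRing A] [Module Φ A] [IsScalarTower Φ A A] [SMulCommClass Φ A A]
    [SemiprimeAlgebra Φ A]
    -- the grading of `A`
    (𝒜 : G → Submodule Φ A) (h𝒜 : DirectSum.IsInternal 𝒜) (h𝒜_mul : SetLike.GradedMul 𝒜)
    -- a subalgebra `Q` of `Q_s(A)` containing `A`, with a grading extending that of `A`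
    (Q : NonUnitalSubalgebra Φ (SymmetricQuotients Φ A))
    (hAQ : ∀ a : A, SymmetricQuotients.incl Φ A a ∈ Q)
    (𝒬 : G → Submodule Φ Q) (h𝒬 : DirectSum.IsInternal 𝒬) (h𝒬_mul : SetLike.GradedMul 𝒬)
    (hA𝒬 : ∀ σ, ∀ a ∈ 𝒜 σ, (⟨SymmetricQuotients.incl Φ A a, hAQ a⟩ : Q) ∈ 𝒬 σ) :
    (∃ f : ModCenter Φ (MinusAlgebra A) →ₗ⁅Φ⁆ ModCenter Φ (MinusAlgebra Q),
      (∀ a : A, f (toModCenter Φ _ (MinusAlgebra.of Φ a)) =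
        toModCenter Φ _ (MinusAlgebra.of Φ (⟨SymmetricQuotients.incl Φ A a, hAQ a⟩ : Q))) ∧
      IsGradedAlgebraOfQuotients (modCenterGrading (minusGrading 𝒜))
        (modCenterGrading (minusGrading 𝒬)) f) ∧
    ((∀ a : A, a + a = 0 → a = 0) →
      ∃ f : ModCenter Φ (derivedIdeal Φ (MinusAlgebra A)) →ₗ⁅Φ⁆
          ModCenter Φ (derivedIdeal Φ (MinusAlgebra Q)),
        (∀ (x : derivedIdeal Φ (MinusAlgebra A)) (a : A), MinusAlgebra.of Φ a = x →
          ∃ y : derivedIdeal Φ (MinusAlgebra Q),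
            (y : MinusAlgebra Q) =
              MinusAlgebra.of Φ (⟨SymmetricQuotients.incl Φ A a, hAQ a⟩ : Q) ∧
            f (toModCenter Φ _ x) = toModCenter Φ _ y) ∧
        IsGradedAlgebraOfQuotients (modCenterGrading (derivedGrading (minusGrading 𝒜)))
          (modCenterGrading (derivedGrading (minusGrading 𝒬))) f) := by
  have h := SymmetricQuotients.hasDenseDenominators Q hAQ
  constructor
  · obtain ⟨f, hf, hq⟩ := h.exists_modCenter_minus h𝒜 h𝒜_mul h𝒬 h𝒬_mul hA𝒬
    exact ⟨f, fun a => hf (MinusAlgebra.of Φ a), hq⟩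
  · intro h2
    obtain ⟨f, hf, hq⟩ := h.exists_modCenter_derived h2 h𝒜 h𝒜_mul h𝒬 h𝒬_mul hA𝒬
    refine ⟨f, fun x a hxa => ⟨derivedMap (minusMap (SymmetricQuotients.inclSubalgebra Q hAQ)) x,
      ?_, hf x⟩, hq⟩
    change minusMap (SymmetricQuotients.inclSubalgebra Q hAQ) (x : MinusAlgebra A) = _
    rw [← hxa]
    rfl
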